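/- Let $M$ be a smooth ($C^\infty$, Hausdorff, second countable) manifold of dimension $m$. A codimension-$d$ almost CR structure on a smooth manifold $N$ is a pair $(HN,J)$ consisting of a smooth real subbundle $HN\subseteq TN$ of rank $\dim N-d$ and a smooth bundle map $J:HN\to HN$ over $\mathrm{id}_N$ with $J^2=-\mathrm{id}$. A smooth map $f:N\to N'$ between manifolds with almost CR structures $(HN,J)$, $(HN',J')$ is an almost CR map if $df(HN)\subseteq HN'$ and $df\circ J=J'\circ df$ on $HN$. Let $(HM,J)$ be a codimension-$d$ almost CR structure on $M$, and let $\mathbb PHM=(HM\setminus\{0\})/\!\sim$ be its complex projectivization, where $\{0\}$ is the zero section and $v\sim w$ if and only if $v=(a+bJ)w$ for some $a,b\in\mathbb R$. It carries the quotient topology and the smooth structure of the bundle of complex projective spaces of the complex vector bundle $(HM,J)$: if $n=(m-d)/2$ is the complex rank of $HM$, $s_0,\dots,s_{n-1}$ is a smooth local complex frame of $HM$ over an open set $U\subseteq M$ and $\varphi$ is a chart of $M$ defined on $U$, then $\bigl[\sum_a w_a s_a(y)\bigr]\mapsto\bigl(\varphi(y),\,w_1/w_0,\dots,w_{n-1}/w_0\bigr)$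 is a chart, defined where $y\in U$ and $w_0\ne0$. (If $n=0$, then $\mathbb PHM=\emptyset$.) Then $\mathbb PHM$ admits a codimension-$d$ almost CR structure such that the projection $Pr:\mathbb PHM\to M$ is an almost CR map. -/

import Mathlib

open scoped Manifold ContDiff Topology
open Module

section Structure

variable {E : Type*} [NormedAddCommGroup E] [NormedSpace ℝ E]
  {H : Type*} [TopologicalSpace H]

/-- A codimension-`d` almost CR structure on a smooth manifold `M`: a smooth real subbundle `HM`
of the tangent bundle whose rank is `dim M - d`, together with a smooth bundle map `J : HM → HM`
with `J² = -id`. -/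
structure AlmostCRStructure (I : ModelWithCorners ℝ E H) (M : Type*) [TopologicalSpace M]
    [ChartedSpace H M] [IsManifold I ∞ M] (d : ℕ) where
  /-- the Levi distribution `HM` -/
  HM : ∀ x : M, Submodule ℝ (TangentSpace I x)
  /-- the bundle map `J : HM → HM` -/
  J : ∀ x : M, HM x →ₗ[ℝ] HM x
  J_J : ∀ (x : M) (v : HM x), J x (J x v) = -v
  codim : ∀ x : M, finrank ℝ (HM x) + d = finrank ℝ (TangentSpace I x)
  /-- `HM` is a smooth subbundle: it has smooth local frames. -/
  exists_frame : ∀ x : M, ∃ U : Set M, IsOpen U ∧ x ∈ U ∧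
    ∃ s : Fin (finrank ℝ (HM x)) → ∀ y : M, HM y,
      (∀ i, ContMDiffOn I I.tangent ∞
        (fun y => (⟨y, (s i y : TangentSpace I y)⟩ : TangentBundle I M)) U) ∧
      ∀ y ∈ U, LinearIndependent ℝ (fun i => s i y) ∧
        Submodule.span ℝ (Set.range fun i => s i y) = ⊤
  /-- `J` is smooth: it maps smooth local sections of `HM` to smooth local sections. -/
  smooth_J : ∀ U : Set M, IsOpen U → ∀ s : ∀ y : M, HM y,
    ContMDiffOn I I.tangent ∞
      (fun y => (⟨y, (s y : TangentSpace I y)⟩ : TangentBundle I M)) U →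
    ContMDiffOn I I.tangent ∞
      (fun y => (⟨y, (J y (s y) : TangentSpace I y)⟩ : TangentBundle I M)) U

/-- A smooth map `f` between almost CR manifolds is an almost CR map if `df (HM) ⊆ HN` and
`df ∘ J = J' ∘ df` on `HM`. -/
structure IsAlmostCRMap {I : ModelWithCorners ℝ E H} {M : Type*} [TopologicalSpace M]
    [ChartedSpace H M] [IsManifold I ∞ M] {d : ℕ}
    {E' : Type*} [NormedAddCommGroup E'] [NormedSpace ℝ E'] {H' : Type*} [TopologicalSpace H']
    {I' : ModelWithCorners ℝ E' H'} {N : Type*} [TopologicalSpace N]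
    [ChartedSpace H' N] [IsManifold I' ∞ N] {d' : ℕ}
    (S : AlmostCRStructure I M d) (S' : AlmostCRStructure I' N d') (f : M → N) : Prop where
  contMDiff : ContMDiff I I' ∞ f
  map_HM : ∀ (x : M) (v : S.HM x), mfderiv I I' f x (v : TangentSpace I x) ∈ S'.HM (f x)
  map_J : ∀ (x : M) (v : S.HM x),
    mfderiv I I' f x (S.J x v : TangentSpace I x) =
      (S'.J (f x) ⟨mfderiv I I' f x (v : TangentSpace I x), map_HM x v⟩ : TangentSpace I' (f x))

end Structure

namespace AlmostCRStructure

/-- A smooth family of injective linear maps has, near a point, a smooth family of left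
inverses. -/
theorem exists_smooth_leftInverse
    {E : Type*} [NormedAddCommGroup E] [NormedSpace ℝ E] {H : Type*} [TopologicalSpace H]
    {I : ModelWithCorners ℝ E H} {M : Type*} [TopologicalSpace M] [ChartedSpace H M]
    {V : Type*} [NormedAddCommGroup V] [NormedSpace ℝ V]
    [FiniteDimensional ℝ V] [FiniteDimensional ℝ E] {T : M → V →L[ℝ] E} {x₀ : M}
    (hT : ContMDiffAt I 𝓘(ℝ, V →L[ℝ] E) ∞ T x₀) (hinj : Function.Injective (T x₀)) :
    ∃ G : M → E →L[ℝ] V, ContMDiffAt I 𝓘(ℝ, E →L[ℝ] V) ∞ G x₀ ∧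
      ∀ᶠ y in 𝓝 x₀, ∀ c, G y (T y c) = c := by
  have : CompleteSpace V := FiniteDimensional.complete ℝ V
  obtain ⟨L, hL⟩ := (T x₀ : V →ₗ[ℝ] E).exists_leftInverse_of_injective
    (LinearMap.ker_eq_bot.2 hinj)
  let L' : E →L[ℝ] V := LinearMap.toContinuousLinearMap L
  let B : M → V →L[ℝ] V := fun y => L'.comp (T y)
  have hB0 : B x₀ = ((ContinuousLinearEquiv.refl ℝ V : V ≃L[ℝ] V) : V →L[ℝ] V) := by
    ext c; exact congrArg (fun f : V →ₗ[ℝ] V => f c) hL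
  have hB : ContMDiffAt I 𝓘(ℝ, V →L[ℝ] V) ∞ B x₀ :=
    ((ContinuousLinearMap.compL ℝ V E V L').contMDiff.contMDiffAt).comp x₀ hT
  have hinv : ContMDiffAt I 𝓘(ℝ, V →L[ℝ] V) ∞ (fun y => (B y).inverse) x₀ := by
    have h := contDiffAt_map_inverse (𝕜 := ℝ) (n := ∞) (ContinuousLinearEquiv.refl ℝ V : V ≃L[ℝ] V)
    rw [← hB0] at h
    exact h.contMDiffAt.comp x₀ hB
  refine ⟨fun y => (B y).inverse.comp L', ?_, ?_⟩
  · exact (((ContinuousLinearMap.compL ℝ E V V).flip L').contMDiff.contMDiffAt).comp x₀ hinv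
  · have h := ContinuousLinearEquiv.nhds (ContinuousLinearEquiv.refl ℝ V : V ≃L[ℝ] V)
    rw [← hB0] at h
    filter_upwards [hB.continuousAt h] with y hy c
    obtain ⟨e, he⟩ := hy
    change (B y).inverse (B y c) = c
    rw [← he]
    simp

section Projectivization

variable {E : Type*} [NormedAddCommGroup E] [NormedSpace ℝ E]
  {H : Type*} [TopologicalSpace H] {I : ModelWithCorners ℝ E H}
  {M : Type*} [TopologicalSpace M] [ChartedSpace H M] [IsManifold I ∞ M] {d : ℕ}
  (S : AlmostCRStructure I M d)

/-- The complex structure on the fibres of `HM`: `a + b i` acts as `a + b J`. -/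
noncomputable def act (x : M) : ℂ →ₐ[ℝ] Module.End ℝ (S.HM x) :=
  Complex.lift ⟨S.J x, by ext1 v; exact S.J_J x v⟩

theorem act_apply (x : M) (z : ℂ) (v : S.HM x) :
    S.act x z v = z.re • v + z.im • S.J x v := by
  simp [act, Complex.liftAux_apply, Module.algebraMap_end_apply]

/-- `HM - {0}`, the complement of the zero section, with the topology induced from `TM`. -/
abbrev NonzeroVec : Type _ := {v : TangentBundle I M // v.2 ∈ S.HM v.1 ∧ v.2 ≠ 0}

/-- The vector of the fibre of `HM` underlying a point of `HM - {0}`. -/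
def NonzeroVec.vec {S : AlmostCRStructure I M d} (v : S.NonzeroVec) : S.HM v.1.1 := ⟨v.1.2, v.2.1⟩

/-- The point of `HM - {0}` given by a nonzero vector in a fibre of `HM`. -/
def NonzeroVec.mk (x : M) (v : S.HM x) (hv : v ≠ 0) : S.NonzeroVec :=
  ⟨⟨x, v⟩, v.2, fun h => hv (Subtype.ext h)⟩

/-- `v ~ w` if and only if `v = (a + b J) w` for some real numbers `a, b`. -/
def projSetoid : Setoid S.NonzeroVec where
  r v w := ∃ z : ℂ, v.1 = ⟨w.1.1, (S.act w.1.1 z w.vec : TangentSpace I w.1.1)⟩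
  iseqv := by
    refine ⟨fun v => ⟨1, by simp [NonzeroVec.vec]⟩, ?_, ?_⟩
    · rintro ⟨⟨x, v⟩, hv, hv0⟩ ⟨⟨y, w⟩, hw, hw0⟩ ⟨z, h⟩
      obtain rfl : x = y := congrArg (·.1) h
      have h' : v = S.act x z ⟨w, hw⟩ := by simpa [NonzeroVec.vec] using h
      have hz : z ≠ 0 := by rintro rfl; apply hv0; simp [h']
      refine ⟨z⁻¹, ?_⟩
      have : (⟨w, hw⟩ : S.HM x) = S.act x z⁻¹ ⟨v, hv⟩ := by
        have e : (⟨v, hv⟩ : S.HM x) = S.act x z ⟨w, hw⟩ := Subtype.ext h'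
        rw [e, ← Module.End.mul_apply, ← map_mul, inv_mul_cancel₀ hz]; simp
      have h2 := congrArg Subtype.val this
      simpa [NonzeroVec.vec] using h2
    · rintro ⟨⟨x, v⟩, hv, hv0⟩ ⟨⟨y, w⟩, hw, hw0⟩ ⟨⟨y', u⟩, hu, hu0⟩ ⟨z, h⟩ ⟨z', h'⟩
      obtain rfl : x = y := congrArg (·.1) h
      obtain rfl : x = y' := congrArg (·.1) h'
      have h1 : v = S.act x z ⟨w, hw⟩ := by simpa [NonzeroVec.vec] using h
      have h2 : w = S.act x z' ⟨u, hu⟩ := by simpa [NonzeroVec.vec] using h'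
      have e : (⟨w, hw⟩ : S.HM x) = S.act x z' ⟨u, hu⟩ := Subtype.ext h2
      refine ⟨z * z', ?_⟩
      simp only [NonzeroVec.vec, map_mul, Module.End.mul_apply, ← e, ← h1]

/-- The complex projectivization `ℙHM = (HM - {0}) / ~`, with the quotient topology. -/
def Proj : Type _ := Quotient S.projSetoid

instance : TopologicalSpace S.Proj := inferInstanceAs (TopologicalSpace (Quotient S.projSetoid))

/-- The quotient map `HM - {0} → ℙHM`. -/
def Proj.mk (v : S.NonzeroVec) : S.Proj := Quotient.mk S.projSetoid v

/-- The projection `Pr : ℙHM → M`. -/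
def Proj.pr : S.Proj → M :=
  Quotient.lift (fun v : S.NonzeroVec => v.1.1) fun _ _ ⟨_, h⟩ => congrArg (·.1) h

/-- The real-linear map `(c a) ↦ ∑ a, c a • s a y`, where `ℂ` acts through `J`. -/
noncomputable def comb {ι : Type*} [Fintype ι] (s : ι → ∀ y : M, S.HM y) (y : M) :
    (ι → ℂ) →ₗ[ℝ] S.HM y :=
  ∑ a, ((S.act y).toLinearMap.flip (s a y)).comp (LinearMap.proj a)

theorem comb_apply {ι : Type*} [Fintype ι] (s : ι → ∀ y : M, S.HM y) (y : M) (c : ι → ℂ) :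
    S.comb s y c = ∑ a, S.act y (c a) (s a y) := by
  simp [comb]

/-- A smooth local frame of the complex vector bundle `(HM, J)` over the open set `U`. -/
structure IsComplexFrameOn {ι : Type*} [Fintype ι] (s : ι → ∀ y : M, S.HM y) (U : Set M) :
    Prop where
  isOpen : IsOpen U
  smooth : ∀ a, ContMDiffOn I I.tangent ∞
    (fun y => (⟨y, (s a y : TangentSpace I y)⟩ : TangentBundle I M)) U
  bijective : ∀ y ∈ U, Function.Bijective (S.comb s y)

open Classical in
/-- The complex coordinates of a vector of `HM` in a frame (zero where `s` is not a frame). -/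
noncomputable def coords {ι : Type*} [Fintype ι] (s : ι → ∀ y : M, S.HM y) (y : M) :
    S.HM y →ₗ[ℝ] (ι → ℂ) :=
  if h : Function.Bijective (S.comb s y) then (LinearEquiv.ofBijective (S.comb s y) h).symm else 0

variable {S} in
theorem coords_comb {ι : Type*} [Fintype ι] {s : ι → ∀ y : M, S.HM y} {y : M}
    (h : Function.Bijective (S.comb s y)) (c : ι → ℂ) : S.coords s y (S.comb s y c) = c := by
  rw [coords, dif_pos h]
  exact (LinearEquiv.ofBijective (S.comb s y) h).symm_apply_apply c

variable {S} in
theorem comb_coords {ι : Type*} [Fintype ι] {s : ι → ∀ y : M, S.HM y} {y : M}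
    (h : Function.Bijective (S.comb s y)) (v : S.HM y) : S.comb s y (S.coords s y v) = v := by
  rw [coords, dif_pos h]
  exact (LinearEquiv.ofBijective (S.comb s y) h).apply_symm_apply v

theorem comb_smul {ι : Type*} [Fintype ι] (s : ι → ∀ y : M, S.HM y) (y : M) (z : ℂ) (c : ι → ℂ) :
    S.comb s y (z • c) = S.act y z (S.comb s y c) := by
  simp [comb_apply, map_sum]

theorem coords_act {ι : Type*} [Fintype ι] (s : ι → ∀ y : M, S.HM y) (y : M) (z : ℂ)
    (v : S.HM y) : S.coords s y (S.act y z v) = z • S.coords s y v := by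
  by_cases h : Function.Bijective (S.comb s y)
  · obtain ⟨c, rfl⟩ := h.2 v
    rw [← comb_smul, coords_comb h, coords_comb h]
  · simp [coords, dif_neg h]


variable {S} in
theorem isBijective_of_injective {ι : Type*} [Fintype ι] [FiniteDimensional ℝ E]
    {s : ι → ∀ y : M, S.HM y} {x y : M}
    (hx : Function.Bijective (S.comb s x)) (hy : Function.Injective (S.comb s y)) :
    Function.Bijective (S.comb s y) := by
  have : ∀ z : M, FiniteDimensional ℝ (TangentSpace I z) := fun z =>
    inferInstanceAs (FiniteDimensional ℝ E)
  have h1 := (LinearEquiv.ofBijective _ hx).finrank_eq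
  have h2 := S.codim x
  have h3 := S.codim y
  have h4 : finrank ℝ (TangentSpace I x) = finrank ℝ (TangentSpace I y) := rfl
  have h5 : finrank ℝ (ι → ℂ) = finrank ℝ (S.HM y) := by omega
  exact ⟨hy, (LinearMap.injective_iff_surjective_of_finrank_eq_finrank h5).1 hy⟩

/-- The map `comb`, read in the trivialization of the tangent bundle at `x₀`. -/
noncomputable def combTriv {ι : Type*} [Fintype ι] (s : ι → ∀ y : M, S.HM y) (x₀ y : M) :
    (ι → ℂ) →L[ℝ] E :=
  ∑ a, ((Complex.reCLM.comp (ContinuousLinearMap.proj a)).smulRight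
      (trivializationAt E (TangentSpace I) x₀ ⟨y, (s a y : TangentSpace I y)⟩).2 +
    (Complex.imCLM.comp (ContinuousLinearMap.proj a)).smulRight
      (trivializationAt E (TangentSpace I) x₀ ⟨y, (S.J y (s a y) : TangentSpace I y)⟩).2)

theorem combTriv_apply {ι : Type*} [Fintype ι] (s : ι → ∀ y : M, S.HM y) {x₀ y : M}
    (hy : y ∈ (trivializationAt E (TangentSpace I) x₀).baseSet) (c : ι → ℂ) :
    S.combTriv s x₀ y c =
      (trivializationAt E (TangentSpace I) x₀ ⟨y, (S.comb s y c : TangentSpace I y)⟩).2 := by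
  have key : ∀ v : TangentSpace I y, (trivializationAt E (TangentSpace I) x₀ ⟨y, v⟩).2 =
      (trivializationAt E (TangentSpace I) x₀).linearMapAt ℝ y v := fun v => by
    rw [Bundle.Trivialization.linearMapAt_apply, if_pos hy]
  simp only [combTriv, key, comb_apply, act_apply]
  simp [map_sum]

theorem combTriv_injective_iff {ι : Type*} [Fintype ι] (s : ι → ∀ y : M, S.HM y) {x₀ y : M}
    (hy : y ∈ (trivializationAt E (TangentSpace I) x₀).baseSet) :
    Function.Injective (S.combTriv s x₀ y) ↔ Function.Injective (S.comb s y) := by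
  have key : ∀ c, S.combTriv s x₀ y c =
      (trivializationAt E (TangentSpace I) x₀).linearEquivAt ℝ y hy (S.comb s y c) := fun c => by
    rw [combTriv_apply S s hy]; rfl
  refine ⟨fun h c c' hc => h (by rw [key, key, hc]), fun h c c' hc => h ?_⟩
  rw [key, key] at hc
  exact Subtype.ext (LinearEquiv.injective _ hc)

variable {S} in
theorem IsComplexFrameOn.contMDiffAt_combTriv {ι : Type*} [Fintype ι]
    {s : ι → ∀ y : M, S.HM y} {U : Set M} (hU : IsOpen U)
    (hs : ∀ a, ContMDiffOn I I.tangent ∞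
      (fun y => (⟨y, (s a y : TangentSpace I y)⟩ : TangentBundle I M)) U) {x₀ : M}
    (hx₀ : x₀ ∈ U) :
    ContMDiffAt I 𝓘(ℝ, (ι → ℂ) →L[ℝ] E) ∞ (S.combTriv s x₀) x₀ := by
  have hb := FiberBundle.mem_baseSet_trivializationAt' (F := E) (E := TangentSpace I) x₀
  have h1 : ∀ a, ContMDiffAt I 𝓘(ℝ, E) ∞ (fun y => (trivializationAt E (TangentSpace I) x₀
      ⟨y, (s a y : TangentSpace I y)⟩).2) x₀ := fun a =>
    ((trivializationAt E (TangentSpace I) x₀).contMDiffAt_section_iff hb).1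
      ((hs a).contMDiffAt (hU.mem_nhds hx₀))
  have h2 : ∀ a, ContMDiffAt I 𝓘(ℝ, E) ∞ (fun y => (trivializationAt E (TangentSpace I) x₀
      ⟨y, (S.J y (s a y) : TangentSpace I y)⟩).2) x₀ := fun a =>
    ((trivializationAt E (TangentSpace I) x₀).contMDiffAt_section_iff hb).1
      ((S.smooth_J U hU _ (hs a)).contMDiffAt (hU.mem_nhds hx₀))
  have h3 : ∀ (f : (ι → ℂ) →L[ℝ] ℝ) {g : M → E}, ContMDiffAt I 𝓘(ℝ, E) ∞ g x₀ →
      ContMDiffAt I 𝓘(ℝ, (ι → ℂ) →L[ℝ] E) ∞ (fun y => f.smulRight (g y)) x₀ := fun f g hg =>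
    ((ContinuousLinearMap.smulRightL ℝ (ι → ℂ) E f).contMDiff.contMDiffAt).comp x₀ hg
  unfold combTriv
  exact ContMDiffAt.sum fun a _ => (h3 _ (h1 a)).add (h3 _ (h2 a))

variable {S} in
/-- Coordinates in a smooth frame depend smoothly on the base point. -/
theorem IsComplexFrameOn.exists_coords {ι : Type*} [Fintype ι] [FiniteDimensional ℝ E]
    {s : ι → ∀ y : M, S.HM y} {U : Set M} (hs : S.IsComplexFrameOn s U) {x₀ : M} (hx₀ : x₀ ∈ U) :
    ∃ G : M → E →L[ℝ] (ι → ℂ), ContMDiffAt I 𝓘(ℝ, E →L[ℝ] (ι → ℂ)) ∞ G x₀ ∧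
      ∀ᶠ y in 𝓝 x₀, ∀ v : S.HM y, S.coords s y v =
        G y (trivializationAt E (TangentSpace I) x₀ ⟨y, (v : TangentSpace I y)⟩).2 := by
  have hb := FiberBundle.mem_baseSet_trivializationAt' (F := E) (E := TangentSpace I) x₀
  have hinj := (S.combTriv_injective_iff s hb).2 (hs.bijective x₀ hx₀).1
  obtain ⟨G, hG, hGT⟩ := exists_smooth_leftInverse
    (IsComplexFrameOn.contMDiffAt_combTriv hs.isOpen hs.smooth hx₀) hinj
  refine ⟨G, hG, ?_⟩
  filter_upwards [hGT, hs.isOpen.mem_nhds hx₀,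
    (trivializationAt E (TangentSpace I) x₀).open_baseSet.mem_nhds hb] with y h1 h2 h3 v
  obtain ⟨c, rfl⟩ := (hs.bijective y h2).2 v
  rw [coords_comb (hs.bijective y h2), ← combTriv_apply S s h3, h1]

/-- Through every nonzero vector of `HM` there is a smooth local complex frame. -/
theorem exists_complexFrame [FiniteDimensional ℝ E] (v : S.NonzeroVec) :
    ∃ (s : Option (Fin ((finrank ℝ E - d) / 2 - 1)) → ∀ y : M, S.HM y) (U : Set M),
      S.IsComplexFrameOn s U ∧ v.1.1 ∈ U ∧ s none v.1.1 = v.vec := by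
  let x : M := v.1.1
  let V := S.HM x
  have hfin : ∀ z : M, FiniteDimensional ℝ (TangentSpace I z) := fun z =>
    inferInstanceAs (FiniteDimensional ℝ E)
  let _ : Module ℂ V := Module.compHom V (S.act x).toRingHom
  have hsm : ∀ (z : ℂ) (w : V), z • w = S.act x z w := fun _ _ => rfl
  have : IsScalarTower ℝ ℂ V := ⟨fun r z w => by simp [hsm]⟩
  have : FiniteDimensional ℂ V := FiniteDimensional.right ℝ ℂ V
  have hv : v.vec ≠ 0 := fun h => v.2.2 (congrArg Subtype.val h)
  have : Nontrivial V := ⟨⟨v.vec, 0, hv⟩⟩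
  have h1 : 2 * finrank ℂ V = finrank ℝ V := by
    rw [← Complex.finrank_real_complex]; exact Module.finrank_mul_finrank ℝ ℂ V
  have h2 : finrank ℝ V + d = finrank ℝ E := S.codim x
  have h3 : 0 < finrank ℂ V := Module.finrank_pos
  set k := (finrank ℝ E - d) / 2 - 1 with hk
  have h4 : finrank ℂ (Option (Fin k) → ℂ) = finrank ℂ V := by
    simp only [Module.finrank_fintype_fun_eq_card, Fintype.card_option, Fintype.card_fin]
    omega
  let φ : (Option (Fin k) → ℂ) ≃ₗ[ℂ] V := LinearEquiv.ofFinrankEq _ _ h4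
  obtain ⟨A, hA⟩ := SeparatingDual.exists_continuousLinearEquiv_apply_eq (R := ℂ)
    (x := (Pi.single none 1 : Option (Fin k) → ℂ)) (y := φ.symm v.vec)
    (by simp) (by simpa using hv)
  let b : Option (Fin k) → V := fun a => φ (A (Pi.single a 1))
  have hb : ∀ c : Option (Fin k) → ℂ, ∑ a, c a • b a = φ (A c) := fun c => by
    have : c = ∑ a, c a • (Pi.single a 1 : Option (Fin k) → ℂ) := by
      ext a; simp [Finset.sum_apply, Pi.single_apply]
    conv_rhs => rw [this]
    simp only [map_sum, map_smul, b]
  obtain ⟨U, hU, hxU, X, hX, hXb⟩ := S.exists_frame x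
  have hr : ∀ a, ∃ r : Fin (finrank ℝ (S.HM x)) → ℝ, ∑ i, r i • X i x = b a := fun a =>
    (Submodule.mem_span_range_iff_exists_fun ℝ).1 ((hXb x hxU).2 ▸ Submodule.mem_top)
  choose r hr using hr
  let s : Option (Fin k) → ∀ y : M, S.HM y := fun a y => ∑ i, r a i • X i y
  have hs : ∀ a, ContMDiffOn I I.tangent ∞
      (fun y => (⟨y, (s a y : TangentSpace I y)⟩ : TangentBundle I M)) U := fun a => by
    have := ContMDiffOn.sum_section (I := I) (F := E) (n := ∞) (V := (TangentSpace I : M → Type _))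
      (s := Finset.univ)
      (t := fun i y => r a i • (X i y : TangentSpace I y)) (u := U)
      (fun i _ => (hX i).const_smul_section (a := r a i))
    simpa [s] using this
  have hbij : Function.Bijective (S.comb s x) := by
    have : ∀ c, S.comb s x c = φ (A c) := fun c => by
      rw [comb_apply, ← hb]
      exact Finset.sum_congr rfl fun a _ => by rw [hsm, ← hr]
    have h5 : (S.comb s x : (Option (Fin k) → ℂ) → V) = φ ∘ A := funext this
    rw [h5]
    exact φ.bijective.comp A.bijective
  have hbase := FiberBundle.mem_baseSet_trivializationAt' (F := E) (E := TangentSpace I) x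
  obtain ⟨G, -, hG⟩ := exists_smooth_leftInverse
    (IsComplexFrameOn.contMDiffAt_combTriv hU hs hxU)
    ((S.combTriv_injective_iff s hbase).2 hbij.1)
  obtain ⟨W, hW, hWo, hxW⟩ := mem_nhds_iff.1 (Filter.inter_mem hG
    (Filter.inter_mem (hU.mem_nhds hxU)
      ((trivializationAt E (TangentSpace I) x).open_baseSet.mem_nhds hbase)))
  refine ⟨s, W, ⟨hWo, fun a => (hs a).mono fun y hy => (hW hy).2.1, fun y hy => ?_⟩, hxW, ?_⟩
  · refine isBijective_of_injective hbij ((S.combTriv_injective_iff s (hW hy).2.2).1 ?_)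
    exact Function.LeftInverse.injective (g := G y) (hW hy).1
  · change ∑ i, r none i • X i x = _
    rw [hr]
    change φ (A _) = _
    rw [hA]; simp

end Projectivization

section Charts

variable {E : Type*} [NormedAddCommGroup E] [NormedSpace ℝ E]
  {M : Type*} [TopologicalSpace M] [ChartedSpace E M] [IsManifold 𝓘(ℝ, E) ∞ M] {d : ℕ}
  (S : AlmostCRStructure 𝓘(ℝ, E) M d)

variable {S} in
theorem Proj.ind {p : S.Proj → Prop}
    (h : ∀ (x : M) (v : S.HM x) (hv : v ≠ 0), p (Proj.mk S (NonzeroVec.mk S x v hv))) (q : S.Proj) :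
    p q := by
  induction q using Quotient.ind with
  | _ w =>
    obtain ⟨⟨x, v⟩, hv, hv0⟩ := w
    exact h x ⟨v, hv⟩ fun h => hv0 (congrArg Subtype.val h)

theorem Proj.mk_eq_mk {x : M} {v w : S.HM x} (hv : v ≠ 0) (hw : w ≠ 0) :
    Proj.mk S (NonzeroVec.mk S x v hv) = Proj.mk S (NonzeroVec.mk S x w hw) ↔
      ∃ z : ℂ, v = S.act x z w := by
  refine Quotient.eq.trans (exists_congr fun z => ?_)
  change (⟨x, (v : TangentSpace 𝓘(ℝ, E) x)⟩ : TangentBundle 𝓘(ℝ, E) M) =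
    ⟨x, (S.act x z w : TangentSpace 𝓘(ℝ, E) x)⟩ ↔ _
  constructor
  · intro h
    have h' : (v : TangentSpace 𝓘(ℝ, E) x) = S.act x z w := by simpa using h
    exact Subtype.ext h'
  · intro h
    rw [h]

@[simp] theorem Proj.pr_mk (v : S.NonzeroVec) : Proj.pr S (Proj.mk S v) = v.1.1 := rfl

/-- The point of `ℂ^(1+k)` with distinguished coordinate `1` and remaining coordinates `z`. -/
def affinePoint {k : ℕ} (z : Fin k → ℂ) : Option (Fin k) → ℂ := fun a => a.elim 1 z

/-- The set of the points of `ℙHM` over `U` whose distinguished homogeneous coordinate, in the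
frame `s`, is nonzero. -/
def affineSource {k : ℕ} (s : Option (Fin k) → ∀ y : M, S.HM y) (U : Set M) : Set S.Proj :=
  Quotient.lift (fun v : S.NonzeroVec => v.1.1 ∈ U ∧ S.coords s v.1.1 v.vec none ≠ 0) (by
    rintro ⟨⟨x, v⟩, hv, hv0⟩ ⟨⟨y, w⟩, hw, hw0⟩ ⟨z, h⟩
    obtain rfl : x = y := congrArg (·.1) h
    have h' : v = S.act x z ⟨w, hw⟩ := by simpa [NonzeroVec.vec] using h
    have hz : z ≠ 0 := by rintro rfl; apply hv0; simp [h']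
    have e : (⟨v, hv⟩ : S.HM x) = S.act x z ⟨w, hw⟩ := Subtype.ext h'
    simp [NonzeroVec.vec, e, coords_act, hz])

/-- The affine coordinates `w i / w none` of a point of `ℙHM` with homogeneous coordinates `w` in
the frame `s`. -/
noncomputable def affineCoords {k : ℕ} (s : Option (Fin k) → ∀ y : M, S.HM y) :
    S.Proj → Fin k → ℂ :=
  Quotient.lift (fun (v : S.NonzeroVec) (i : Fin k) =>
    S.coords s v.1.1 v.vec (some i) / S.coords s v.1.1 v.vec none) (by
    rintro ⟨⟨x, v⟩, hv, hv0⟩ ⟨⟨y, w⟩, hw, hw0⟩ ⟨z, h⟩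
    obtain rfl : x = y := congrArg (·.1) h
    have h' : v = S.act x z ⟨w, hw⟩ := by simpa [NonzeroVec.vec] using h
    have hz : z ≠ 0 := by rintro rfl; apply hv0; simp [h']
    have e : (⟨v, hv⟩ : S.HM x) = S.act x z ⟨w, hw⟩ := Subtype.ext h'
    funext i
    simp [NonzeroVec.vec, e, coords_act, mul_div_mul_left _ _ hz])

theorem mk_mem_affineSource {k : ℕ} (s : Option (Fin k) → ∀ y : M, S.HM y) (U : Set M) (x : M)
    (v : S.HM x) (hv : v ≠ 0) : Proj.mk S (NonzeroVec.mk S x v hv) ∈ S.affineSource s U ↔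
      x ∈ U ∧ S.coords s x v none ≠ 0 := Iff.rfl

theorem affineCoords_mk {k : ℕ} (s : Option (Fin k) → ∀ y : M, S.HM y) (x : M)
    (v : S.HM x) (hv : v ≠ 0) (i : Fin k) :
    S.affineCoords s (Proj.mk S (NonzeroVec.mk S x v hv)) i =
      S.coords s x v (some i) / S.coords s x v none := rfl

theorem Proj.isQuotientMap_mk : Topology.IsQuotientMap (Proj.mk S) :=
  isQuotientMap_quotient_mk'

/-- The data of a standard chart of `ℙHM`: a chart `e` of `M` and a smooth complex frame `s` of
`HM` over an open set `U` on which `e` is defined. -/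
structure ProjChartData (k : ℕ) where
  e : OpenPartialHomeomorph M E
  mem_atlas : e ∈ atlas E M
  U : Set M
  subset_source : U ⊆ e.source
  s : Option (Fin k) → ∀ y : M, S.HM y
  frame : S.IsComplexFrameOn s U

variable {S} {k : ℕ}

theorem IsComplexFrameOn.comb_affinePoint_ne_zero {s : Option (Fin k) → ∀ y : M, S.HM y}
    {U : Set M} (hs : S.IsComplexFrameOn s U) {y : M} (hy : y ∈ U) (z : Fin k → ℂ) :
    S.comb s y (affinePoint z) ≠ 0 := by
  intro h
  rw [← map_zero (S.comb s y)] at h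
  exact one_ne_zero (congrFun ((hs.bijective y hy).1 h) none)

open Classical in
/-- The inverse of the standard chart: `(u, z)` is sent to the class of `s none + ∑ z i • s i` in
the fibre over `e⁻¹ u` (and to the irrelevant value `p` where this vector vanishes). -/
noncomputable def ProjChartData.inv (D : S.ProjChartData k) (p : S.Proj)
    (q : E × (Fin k → ℂ)) : S.Proj :=
  if h : S.comb D.s (D.e.symm q.1) (affinePoint q.2) ≠ 0 then
    Proj.mk S (NonzeroVec.mk S (D.e.symm q.1) _ h) else p

theorem ProjChartData.inv_of_mem (D : S.ProjChartData k) (p : S.Proj) {q : E × (Fin k → ℂ)}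
    (hq : D.e.symm q.1 ∈ D.U) : D.inv p q = Proj.mk S (NonzeroVec.mk S (D.e.symm q.1) _
      (D.frame.comb_affinePoint_ne_zero hq q.2)) := by
  rw [ProjChartData.inv, dif_pos]

theorem ProjChartData.isOpen_target (D : S.ProjChartData k) :
    IsOpen {q : E × (Fin k → ℂ) | q.1 ∈ D.e.target ∧ D.e.symm q.1 ∈ D.U} :=
  (D.e.isOpen_inter_preimage_symm D.frame.isOpen).preimage continuous_fst

theorem continuousAt_coords [FiniteDimensional ℝ E] {ι : Type*} [Fintype ι]
    {s : ι → ∀ y : M, S.HM y} {U : Set M} (hs : S.IsComplexFrameOn s U) (v : S.NonzeroVec)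
    (hv : v.1.1 ∈ U) : ContinuousAt (fun w : S.NonzeroVec => S.coords s w.1.1 w.vec) v := by
  obtain ⟨G, hG, hGc⟩ := hs.exists_coords hv
  have h1 : ContinuousAt (fun w : S.NonzeroVec => w.1.1) v :=
    ((FiberBundle.continuous_proj E (TangentSpace 𝓘(ℝ, E) (M := M))).comp
      continuous_subtype_val).continuousAt
  have h2 : ContinuousAt (fun w : S.NonzeroVec =>
      (trivializationAt E (TangentSpace 𝓘(ℝ, E)) v.1.1 w.1).2) v :=
    ((FiberBundle.continuousAt_totalSpace E _).1 continuous_subtype_val.continuousAt).2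
  have h3 : ContinuousAt (fun w : S.NonzeroVec => G w.1.1) v :=
    ContinuousAt.comp (f := fun w : S.NonzeroVec => w.1.1) hG.continuousAt h1
  refine (h3.clm_apply h2).congr ?_
  filter_upwards [h1 hGc] with w hw
  exact (hw w.vec).symm

theorem continuous_base : Continuous fun w : S.NonzeroVec => w.1.1 :=
  (FiberBundle.continuous_proj E (TangentSpace 𝓘(ℝ, E) (M := M))).comp continuous_subtype_val

theorem ProjChartData.isOpen_source [FiniteDimensional ℝ E] (D : S.ProjChartData k) :
    IsOpen (S.affineSource D.s D.U) := by
  refine isOpen_coinduced.2 (isOpen_iff_mem_nhds.2 ?_)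
  rintro v ⟨h1, h2⟩
  have hc := (continuous_apply none).continuousAt.comp (continuousAt_coords D.frame v h1)
  filter_upwards [continuous_base.continuousAt (D.frame.isOpen.mem_nhds h1),
    hc (isOpen_ne.mem_nhds h2)] with w hw1 hw2
  exact ⟨hw1, hw2⟩

/-- The standard chart of `ℙHM` given by a chart of `M` and a local complex frame of `HM`: it sends
the class of `∑ w a • s a` over `y` to `(e y, (w i / w none) i)`. The point `p` is an irrelevant
value of the inverse outside the target. -/
noncomputable def ProjChartData.chart [FiniteDimensional ℝ E] (D : S.ProjChartData k)
    (p : S.Proj) : OpenPartialHomeomorph S.Proj (E × (Fin k → ℂ)) where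
  toFun q := (D.e (Proj.pr S q), S.affineCoords D.s q)
  invFun := D.inv p
  source := S.affineSource D.s D.U
  target := {q | q.1 ∈ D.e.target ∧ D.e.symm q.1 ∈ D.U}
  map_source' q := by
    induction q using Proj.ind with
    | h x v hv =>
      rw [mk_mem_affineSource]
      rintro ⟨h1, -⟩
      have h3 : D.e.symm (D.e x) = x := D.e.left_inv (D.subset_source h1)
      refine ⟨D.e.map_source (D.subset_source h1), ?_⟩
      change D.e.symm (D.e x) ∈ D.U
      rwa [h3]
  map_target' q := by
    rintro ⟨h1, h2⟩
    rw [D.inv_of_mem p h2, mk_mem_affineSource, coords_comb (D.frame.bijective _ h2)]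
    exact ⟨h2, one_ne_zero⟩
  left_inv' q := by
    induction q using Proj.ind with
    | h x v hv =>
      rw [mk_mem_affineSource]
      rintro ⟨h1, h2⟩
      have h3 : D.e.symm (D.e x) = x := D.e.left_inv (D.subset_source h1)
      have key : ∀ (y : M) (hy : y = x) (z : Fin k → ℂ)
          (_ : z = S.affineCoords D.s (Proj.mk S (NonzeroVec.mk S x v hv)))
          (h : S.comb D.s y (affinePoint z) ≠ 0),
          Proj.mk S (NonzeroVec.mk S y _ h) = Proj.mk S (NonzeroVec.mk S x v hv) := by
        rintro y rfl z hz h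
        rw [Proj.mk_eq_mk]
        refine ⟨(S.coords D.s y v none)⁻¹, ?_⟩
        conv_rhs => rw [← comb_coords (D.frame.bijective y h1) v]
        rw [← comb_smul, comb_coords (D.frame.bijective y h1) v, hz]
        congr 1
        funext a
        cases a with
        | none => simp [affinePoint, h2]
        | some i =>
          simp only [affinePoint, Option.elim_some, affineCoords_mk, Pi.smul_apply, smul_eq_mul]
          exact div_eq_inv_mul _ _
      rw [D.inv_of_mem p (show D.e.symm (D.e x) ∈ D.U by rwa [h3])]
      exact key _ h3 _ rfl _
  right_inv' q := by
    rintro ⟨h1, h2⟩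
    rw [D.inv_of_mem p h2]
    refine Prod.ext (D.e.right_inv h1) (funext fun i => ?_)
    refine (affineCoords_mk S D.s _ _ _ i).trans ?_
    rw [coords_comb (D.frame.bijective _ h2)]
    simp [affinePoint]
  open_source := D.isOpen_source
  open_target := D.isOpen_target
  continuousOn_toFun := by
    refine ((Proj.isQuotientMap_mk S).continuousOn_isOpen_iff D.isOpen_source).2 ?_
    rintro v ⟨h1, h2⟩
    have hc := continuousAt_coords D.frame v h1
    have he : ContinuousAt D.e v.1.1 := D.e.continuousAt (D.subset_source h1)
    suffices h : ContinuousAt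
        (fun w : S.NonzeroVec => (D.e w.1.1, S.affineCoords D.s (Proj.mk S w))) v from
      h.continuousWithinAt
    refine ContinuousAt.prodMk ?_ (continuousAt_pi.2 fun i => ?_)
    · exact ContinuousAt.comp (f := fun w : S.NonzeroVec => w.1.1) (g := D.e) he
        (continuous_base (S := S)).continuousAt
    · change ContinuousAt (fun w : S.NonzeroVec => S.coords D.s w.1.1 w.vec (some i) /
        S.coords D.s w.1.1 w.vec none) v
      exact (continuousAt_pi.1 hc (some i)).div₀ (continuousAt_pi.1 hc none) h2
  continuousOn_invFun := by
    rw [continuousOn_iff_continuous_domRestrict]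
    have : Set.domRestrict {q : E × (Fin k → ℂ) | q.1 ∈ D.e.target ∧ D.e.symm q.1 ∈ D.U} (D.inv p) =
        fun q => Proj.mk S (NonzeroVec.mk S (D.e.symm q.1.1) _
          (D.frame.comb_affinePoint_ne_zero q.2.2 q.1.2)) :=
      funext fun q => D.inv_of_mem p q.2.2
    rw [this]
    refine (Proj.isQuotientMap_mk S).continuous.comp (Continuous.subtype_mk ?_ _)
    refine continuous_iff_continuousAt.2 fun q => ?_
    have hb : ContinuousAt (fun q : {q : E × (Fin k → ℂ) | q.1 ∈ D.e.target ∧ D.e.symm q.1 ∈ D.U} =>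
        D.e.symm q.1.1) q :=
      ContinuousAt.comp (f := fun q : {q : E × (Fin k → ℂ) | q.1 ∈ D.e.target ∧
        D.e.symm q.1 ∈ D.U} => q.1.1) (D.e.symm.continuousAt q.2.1)
        (continuous_fst.comp continuous_subtype_val).continuousAt
    refine (FiberBundle.continuousAt_totalSpace E _).2 ⟨hb, ?_⟩
    have hT := (IsComplexFrameOn.contMDiffAt_combTriv D.frame.isOpen D.frame.smooth
      q.2.2).continuousAt
    have hT' := ContinuousAt.comp (f := fun q : {q : E × (Fin k → ℂ) | q.1 ∈ D.e.target ∧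
        D.e.symm q.1 ∈ D.U} => D.e.symm q.1.1) hT hb
    have hz : ContinuousAt (fun q : {q : E × (Fin k → ℂ) | q.1 ∈ D.e.target ∧
        D.e.symm q.1 ∈ D.U} => affinePoint q.1.2) q := by
      refine continuousAt_pi.2 fun a => ?_
      cases a with
      | none => exact continuousAt_const
      | some i =>
        exact ((continuous_apply i).comp (continuous_snd.comp continuous_subtype_val)).continuousAt
    refine (hT'.clm_apply hz).congr ?_
    filter_upwards [hb ((trivializationAt E (TangentSpace 𝓘(ℝ, E))
      (D.e.symm q.1.1)).open_baseSet.mem_nhds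
        (FiberBundle.mem_baseSet_trivializationAt' (D.e.symm q.1.1)))] with r hr
    exact combTriv_apply S D.s hr _

theorem ProjChartData.chart_apply [FiniteDimensional ℝ E] (D : S.ProjChartData k) (p : S.Proj)
    (x : M) (v : S.HM x) (hv : v ≠ 0) :
    D.chart p (Proj.mk S (NonzeroVec.mk S x v hv)) =
      (D.e x, fun i => S.coords D.s x v (some i) / S.coords D.s x v none) := rfl

theorem ProjChartData.contDiffOn_transition [FiniteDimensional ℝ E] (D D' : S.ProjChartData k)
    (p p' : S.Proj) :
    ContDiffOn ℝ ∞ (D'.chart p' ∘ (D.chart p).symm) ((D.chart p).symm ≫ₕ D'.chart p').source := by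
  intro q hq
  have hsrc := ((D.chart p).symm ≫ₕ D'.chart p').open_source
  have h0 : ∀ r ∈ ((D.chart p).symm ≫ₕ D'.chart p').source, r.1 ∈ D.e.target ∧
      D.e.symm r.1 ∈ D.U ∧ D.e.symm r.1 ∈ D'.U ∧
      S.coords D'.s (D.e.symm r.1) (S.comb D.s (D.e.symm r.1) (affinePoint r.2)) none ≠ 0 ∧
      (D'.chart p' ∘ (D.chart p).symm) r = (D'.e (D.e.symm r.1), fun i =>
        S.coords D'.s (D.e.symm r.1) (S.comb D.s (D.e.symm r.1) (affinePoint r.2)) (some i) /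
        S.coords D'.s (D.e.symm r.1) (S.comb D.s (D.e.symm r.1) (affinePoint r.2)) none) := by
    rintro r ⟨⟨h1, h2⟩, h3⟩
    have h4 : D.inv p r ∈ S.affineSource D'.s D'.U := h3
    have h5 : (D.chart p).symm r = D.inv p r := rfl
    rw [D.inv_of_mem p h2] at h4 h5
    rw [mk_mem_affineSource] at h4
    refine ⟨h1, h2, h4.1, h4.2, ?_⟩
    rw [Function.comp_apply, h5, ProjChartData.chart_apply]
  obtain ⟨h1, h2, h3, h4, -⟩ := h0 q hq
  obtain ⟨G, hG, hGc⟩ := D'.frame.exists_coords h3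
  have hT := IsComplexFrameOn.contMDiffAt_combTriv D.frame.isOpen D.frame.smooth h2
  have hes : ContMDiffAt 𝓘(ℝ, E) 𝓘(ℝ, E) ∞ D.e.symm q.1 :=
    contMDiffAt_symm_of_mem_maximalAtlas
      (IsManifold.subset_maximalAtlas (I := 𝓘(ℝ, E)) (n := ∞) D.mem_atlas) h1
  have he' : ContMDiffAt 𝓘(ℝ, E) 𝓘(ℝ, E) ∞ D'.e (D.e.symm q.1) :=
    contMDiffAt_of_mem_maximalAtlas
      (IsManifold.subset_maximalAtlas (I := 𝓘(ℝ, E)) (n := ∞) D'.mem_atlas) (D'.subset_source h3)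
  have hfst : ContDiffAt ℝ ∞ (fun r : E × (Fin k → ℂ) => r.1) q := contDiff_fst.contDiffAt
  have a1 : ContDiffAt ℝ ∞ (fun r : E × (Fin k → ℂ) => D'.e (D.e.symm r.1)) q :=
    ContDiffAt.comp q (g := fun u => D'.e (D.e.symm u)) (he'.comp q.1 hes).contDiffAt hfst
  have a2 : ContDiffAt ℝ ∞ (fun r : E × (Fin k → ℂ) => G (D.e.symm r.1)) q :=
    ContDiffAt.comp q (g := fun u => G (D.e.symm u)) (hG.comp q.1 hes).contDiffAt hfst
  have a3 : ContDiffAt ℝ ∞ (fun r : E × (Fin k → ℂ) =>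
      S.combTriv D.s (D.e.symm q.1) (D.e.symm r.1)) q :=
    ContDiffAt.comp q (g := fun u => S.combTriv D.s (D.e.symm q.1) (D.e.symm u))
      (hT.comp q.1 hes).contDiffAt hfst
  have a4 : ContDiffAt ℝ ∞ (fun r : E × (Fin k → ℂ) => affinePoint r.2) q := by
    refine contDiffAt_pi.2 fun a => ?_
    cases a with
    | none => exact contDiffAt_const
    | some i => exact ((contDiff_apply ℝ ℂ i).comp contDiff_snd).contDiffAt
  have a5 : ContDiffAt ℝ ∞ (fun r : E × (Fin k → ℂ) => G (D.e.symm r.1)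
      (S.combTriv D.s (D.e.symm q.1) (D.e.symm r.1) (affinePoint r.2))) q :=
    a2.clm_apply (a3.clm_apply a4)
  have hcont : ContinuousAt (fun r : E × (Fin k → ℂ) => D.e.symm r.1) q :=
    ContinuousAt.comp (f := fun r : E × (Fin k → ℂ) => r.1) (D.e.symm.continuousAt h1)
      continuousAt_fst
  have a6 : ContDiffAt ℝ ∞ (fun r : E × (Fin k → ℂ) => S.coords D'.s (D.e.symm r.1)
      (S.comb D.s (D.e.symm r.1) (affinePoint r.2))) q := by
    refine a5.congr_of_eventuallyEq ?_
    filter_upwards [hcont hGc, hcont ((trivializationAt E (TangentSpace 𝓘(ℝ, E))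
      (D.e.symm q.1)).open_baseSet.mem_nhds
        (FiberBundle.mem_baseSet_trivializationAt' (D.e.symm q.1)))] with r hr1 hr2
    rw [hr1, combTriv_apply S D.s hr2]
  have a7 := contDiffAt_pi.1 a6
  refine ContDiffAt.contDiffWithinAt ?_
  refine (a1.prodMk (contDiffAt_pi.2 fun i =>
    (a7 (some i)).mul ((a7 none).inv h4))).congr_of_eventuallyEq
    ?_
  filter_upwards [hsrc.mem_nhds hq] with r hr
  simp only [(h0 r hr).2.2.2.2, div_eq_mul_inv]
  rfl

theorem Proj.exists_chart [FiniteDimensional ℝ E] (q : S.Proj) :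
    ∃ D : S.ProjChartData ((finrank ℝ E - d) / 2 - 1), q ∈ (D.chart q).source := by
  induction q using Proj.ind with
  | h x v hv =>
    obtain ⟨s, U, hs, hxU, hsv⟩ := S.exists_complexFrame (NonzeroVec.mk S x v hv)
    have hxU' : x ∈ U := hxU
    have hsv' : s none x = v := hsv
    let W := U ∩ (chartAt E x).source
    have hW : S.IsComplexFrameOn s W :=
      ⟨hs.isOpen.inter (chartAt E x).open_source,
        fun a => (hs.smooth a).mono Set.inter_subset_left, fun y hy => hs.bijective y hy.1⟩
    refine ⟨⟨chartAt E x, chart_mem_atlas E x, W, Set.inter_subset_right, s, hW⟩,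
      ⟨hxU', mem_chart_source E x⟩, ?_⟩
    change S.coords s x v none ≠ 0
    have : v = S.comb s x (Pi.single none 1) := by
      rw [comb_apply, Finset.sum_eq_single none (fun a _ ha => by simp [ha]) (by simp)]
      simp [hsv']
    rw [this, coords_comb (hs.bijective x hxU')]
    simp

/-- The model space of `ℙHM`, for `M` modelled on `E`. Here `n = (dim E - d) / 2` is the complex rank
of `HM`, and `n - 1` is the complex dimension of the fibres of `ℙHM` (if `n = 0`, `ℙHM` is empty). -/
abbrev ProjModel (E : Type*) [NormedAddCommGroup E] [NormedSpace ℝ E] (d : ℕ) : Type _ :=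
  E × (Fin ((finrank ℝ E - d) / 2 - 1) → ℂ)

/-- The smooth atlas of `ℙHM`: all standard charts. -/
noncomputable instance Proj.instChartedSpace [FiniteDimensional ℝ E] :
    ChartedSpace (ProjModel E d) S.Proj where
  atlas := {φ | ∃ (D : S.ProjChartData ((finrank ℝ E - d) / 2 - 1)) (p : S.Proj), φ = D.chart p}
  chartAt q := (Proj.exists_chart q).choose.chart q
  mem_chart_source q := (Proj.exists_chart q).choose_spec
  chart_mem_atlas q := ⟨_, q, rfl⟩

instance Proj.instIsManifold [FiniteDimensional ℝ E] :
    IsManifold 𝓘(ℝ, ProjModel E d) ∞ S.Proj := by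
  refine isManifold_of_contDiffOn _ _ _ ?_
  rintro _ _ ⟨D, p, rfl⟩ ⟨D', p', rfl⟩
  simpa using D.contDiffOn_transition D' p p'

end Charts

end AlmostCRStructure

/-! Let `n` be the complex rank of `HM`. The distribution on `ℙHM` is the preimage of `HM` under the
derivative of `Pr`. It contains all vertical vectors, so passing from `M` to `ℙHM` raises its rank
and the dimension of the manifold by the same number, and the codimension stays `d`. The remaining
task is to find a complex structure on this distribution that lifts `J`.

Near a point such a structure exists: a standard chart, made from a chart of `M` and a complex frame
of `HM`, splits the distribution as `HM × ℂ^(n-1)` through the derivatives of `Pr` and of the affine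
fibre coordinates, and one takes `J × i` (`ProjChartData.localJ`). Different charts give different
structures, because the horizontal complement depends on the chart. They agree on vertical vectors,
however: on a fixed fibre the transition between affine coordinates is fractional linear, hence
holomorphic (`ProjChartData.exists_complexLinear_fibreDeriv`).

The structures that lift a given `J` and agree on the vertical space form an affine space. If `J₁ =
J₀ + A` are two of them, then `A` maps into the vertical space and vanishes there, so `A² = 0` and
`J₁² = -1` becomes the linear condition `A J₀ + J₀ A = 0`. Averages are therefore again complex
structures (`sum_smul_complexStructure`), and a partition of unity glues the local ones.

The partition of unity requires `ℙHM` to be Hausdorff and σ-compact, which is proved from the same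
properties of `M`: Hausdorff and second countable (`Proj.instT2Space`,
`Proj.instSigmaCompactSpace`). -/

namespace AlmostCRStructure

/-! ### Topology of `ℙHM`: Hausdorff and σ-compact -/

section ProjTopology

variable {E : Type*} [NormedAddCommGroup E] [NormedSpace ℝ E]
  {M : Type*} [TopologicalSpace M] [ChartedSpace E M] [IsManifold 𝓘(ℝ, E) ∞ M] {d : ℕ}
  {S : AlmostCRStructure 𝓘(ℝ, E) M d}

theorem Proj.continuous_pr : Continuous (Proj.pr S) :=
  (Proj.isQuotientMap_mk S).continuous_iff.2 continuous_base

theorem ProjChartData.pr_mem_of_mem_source {k : ℕ} (D : S.ProjChartData k) {q : S.Proj}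
    (hq : q ∈ S.affineSource D.s D.U) : Proj.pr S q ∈ D.U := by
  induction q using Proj.ind with
  | h x v hv => exact hq.1

/-- The share `|w none|² / ∑ |w a|²` of the distinguished homogeneous coordinate, in the frame
`s`. -/
noncomputable def weight {k : ℕ} (s : Option (Fin k) → ∀ y : M, S.HM y) : S.Proj → ℝ :=
  Quotient.lift (fun v : S.NonzeroVec =>
    ‖S.coords s v.1.1 v.vec none‖ ^ 2 / ∑ a, ‖S.coords s v.1.1 v.vec a‖ ^ 2) (by
    rintro ⟨⟨x, v⟩, hv, hv0⟩ ⟨⟨y, w⟩, hw, hw0⟩ ⟨z, h⟩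
    obtain rfl : x = y := congrArg (·.1) h
    have h' : v = S.act x z ⟨w, hw⟩ := by simpa [NonzeroVec.vec] using h
    have hz : z ≠ 0 := by rintro rfl; apply hv0; simp [h']
    have e : (⟨v, hv⟩ : S.HM x) = S.act x z ⟨w, hw⟩ := Subtype.ext h'
    have hz' : ‖z‖ ^ 2 ≠ 0 := by simpa using hz
    simp only [NonzeroVec.vec, e, coords_act, Pi.smul_apply, smul_eq_mul, norm_mul, mul_pow,
      ← Finset.mul_sum]
    exact mul_div_mul_left _ _ hz')

theorem coords_ne_zero {ι : Type*} [Fintype ι] {s : ι → ∀ y : M, S.HM y} {U : Set M}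
    (hs : S.IsComplexFrameOn s U) {x : M} (hx : x ∈ U) {v : S.HM x} (hv : v ≠ 0) :
    S.coords s x v ≠ 0 := fun h => hv <| by
  rw [← comb_coords (hs.bijective x hx) v, h, map_zero]

theorem sum_sq_norm_coords_pos {ι : Type*} [Fintype ι] {s : ι → ∀ y : M, S.HM y} {U : Set M}
    (hs : S.IsComplexFrameOn s U) {x : M} (hx : x ∈ U) {v : S.HM x} (hv : v ≠ 0) :
    0 < ∑ a, ‖S.coords s x v a‖ ^ 2 := by
  obtain ⟨a, ha⟩ := Function.ne_iff.1 (coords_ne_zero hs hx hv)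
  refine Finset.sum_pos' (fun _ _ => by positivity) ⟨a, Finset.mem_univ a, ?_⟩
  have : 0 < ‖S.coords s x v a‖ := norm_pos_iff.2 ha
  positivity

/-- Unlike the affine coordinates, the weight is continuous over all of `U`, also where the
distinguished coordinate vanishes: its denominator is zero only for the zero vector. This is what
lets it separate two points of a fibre that lie in no common affine chart of the given frame. -/
theorem continuousAt_weight [FiniteDimensional ℝ E] {k : ℕ}
    {s : Option (Fin k) → ∀ y : M, S.HM y} {U : Set M} (hs : S.IsComplexFrameOn s U) {q : S.Proj}
    (hq : Proj.pr S q ∈ U) : ContinuousAt (weight s) q := by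
  have ho : IsOpen (Proj.pr S ⁻¹' U) := hs.isOpen.preimage Proj.continuous_pr
  refine ContinuousOn.continuousAt (s := Proj.pr S ⁻¹' U) ?_ (ho.mem_nhds hq)
  refine ((Proj.isQuotientMap_mk S).continuousOn_isOpen_iff ho).2 fun v hv => ?_
  have hc := continuousAt_pi.1 (continuousAt_coords hs v hv)
  have hv0 : v.vec ≠ 0 := fun h => v.2.2 (congrArg Subtype.val h)
  refine ContinuousAt.continuousWithinAt ?_
  change ContinuousAt (fun v : S.NonzeroVec =>
    ‖S.coords s v.1.1 v.vec none‖ ^ 2 / ∑ a, ‖S.coords s v.1.1 v.vec a‖ ^ 2) v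
  exact ((hc none).norm.pow 2).div₀ (tendsto_finsetSum _ fun a _ => (hc a).norm.pow 2)
    (sum_sq_norm_coords_pos hs hv hv0).ne'

/-- Points over different base points are separated by `Pr`. Within a fibre, a frame whose
distinguished member is `v` has weight `1` at the class of `v` and at no other point of that fibre.
-/
instance Proj.instT2Space [FiniteDimensional ℝ E] [T2Space M] : T2Space S.Proj := by
  refine t2Space_iff_disjoint_nhds.2 fun p q hpq => ?_
  by_cases hne : Proj.pr S p = Proj.pr S q
  swap
  · exact Proj.continuous_pr.continuousAt.tendsto.disjoint (disjoint_nhds_nhds.2 hne)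
      Proj.continuous_pr.continuousAt.tendsto
  induction p using Proj.ind with
  | h x v hv =>
  induction q using Proj.ind with
  | h y w hw =>
    obtain rfl : x = y := hne
    obtain ⟨s, U, hs, hxU, hsv⟩ := S.exists_complexFrame (NonzeroVec.mk S x v hv)
    have hxU' : x ∈ U := hxU
    have hsv' : s none x = v := hsv
    have hcomb : ∀ c : ℂ, S.comb s x (Pi.single none c) = S.act x c v := fun c => by
      rw [comb_apply, Finset.sum_eq_single none (fun a _ ha => by simp [ha]) (by simp)]
      simp [hsv']
    have hp : weight s (Proj.mk S (NonzeroVec.mk S x v hv)) = 1 := by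
      change ‖S.coords s x v none‖ ^ 2 / ∑ a, ‖S.coords s x v a‖ ^ 2 = 1
      have : S.coords s x v = Pi.single none 1 := by
        conv_lhs => rw [show v = S.comb s x (Pi.single none 1) by simp [hcomb]]
        exact coords_comb (hs.bijective x hxU') _
      simp [this, Fintype.sum_option]
    refine (continuousAt_weight hs (q := Proj.mk S (NonzeroVec.mk S x v hv)) hxU').tendsto.disjoint
      (disjoint_nhds_nhds.2 fun h => hpq ?_)
      (continuousAt_weight hs (q := Proj.mk S (NonzeroVec.mk S x w hw)) hxU').tendsto
    -- Weight `1` at the class of `w` forces all other coordinates to vanish, so `w` is a complex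
    -- multiple of `v`.
    rw [hp] at h
    replace h : 1 = ‖S.coords s x w none‖ ^ 2 / ∑ a, ‖S.coords s x w a‖ ^ 2 := h
    rw [eq_comm, div_eq_one_iff_eq (sum_sq_norm_coords_pos hs hxU' hw).ne',
      Fintype.sum_option, left_eq_add,
      Finset.sum_eq_zero_iff_of_nonneg fun _ _ => by positivity] at h
    have hw' : S.coords s x w = Pi.single none (S.coords s x w none) := by
      funext a
      cases a with
      | none => simp
      | some i => simpa using h i (Finset.mem_univ i)
    have hwv : w = S.act x (S.coords s x w none) v := by
      rw [← hcomb, ← hw', comb_coords (hs.bijective x hxU')]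
    exact ((Proj.mk_eq_mk S hw hv).2 ⟨_, hwv⟩).symm

/-- A chart domain of the tangent bundle is the full preimage of a chart domain of `M`. Countably
many charts covering `M` therefore give countably many covering the tangent bundle; they are indexed
by zero vectors because only the base point matters. -/
theorem secondCountableTopology_tangentBundle {E : Type*} [NormedAddCommGroup E]
    [NormedSpace ℝ E] [SecondCountableTopology E] {H : Type*} [TopologicalSpace H]
    [SecondCountableTopology H] (I : ModelWithCorners ℝ E H) (M : Type*) [TopologicalSpace M]
    [ChartedSpace H M] [IsManifold I 1 M] [SecondCountableTopology M] :
    SecondCountableTopology (TangentBundle I M) := by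
  obtain ⟨t, htc, htU⟩ := TopologicalSpace.countable_cover_nhds
    fun x : M => (chartAt H x).open_source.mem_nhds (mem_chart_source H x)
  have : SecondCountableTopology (ModelProd H E) :=
    inferInstanceAs (SecondCountableTopology (H × E))
  refine ChartedSpace.secondCountable_of_countable_cover (ModelProd H E)
    (s := (fun x : M => (⟨x, 0⟩ : TangentBundle I M)) '' t) ?_ (htc.image _)
  refine Set.eq_univ_of_forall fun v => ?_
  obtain ⟨x, hxt, hx⟩ := Set.mem_iUnion₂.1 (htU.ge (Set.mem_univ v.1))
  exact Set.mem_iUnion₂.2 ⟨_, Set.mem_image_of_mem _ hxt,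
    (TangentBundle.mem_chart_source_iff v ⟨x, 0⟩).2 hx⟩

instance Proj.instSigmaCompactSpace [FiniteDimensional ℝ E] [SecondCountableTopology M] :
    SigmaCompactSpace S.Proj := by
  have : ProperSpace E := FiniteDimensional.proper ℝ E
  have : SecondCountableTopology (TangentBundle 𝓘(ℝ, E) M) :=
    have : IsManifold 𝓘(ℝ, E) 1 M := .of_le (n := ∞) (by norm_cast)
    secondCountableTopology_tangentBundle _ _
  -- The Lindelöf property passes to arbitrary quotients, whereas second countability does not. The
  -- latter is recovered from a countable cover by charts, and local compactness of the model then
  -- gives σ-compactness.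
  have : LindelofSpace S.Proj := inferInstanceAs (LindelofSpace (Quotient S.projSetoid))
  obtain ⟨t, htc, htU⟩ := countable_cover_nhds
    fun q : S.Proj => (chartAt (ProjModel E d) q).open_source.mem_nhds (mem_chart_source _ q)
  have := ChartedSpace.secondCountable_of_countable_cover (ProjModel E d) htU htc
  have := ChartedSpace.locallyCompactSpace (ProjModel E d) S.Proj
  infer_instance

end ProjTopology

end AlmostCRStructure

/-! ### Tangent maps of smooth maps and smoothness of vector fields -/

section TangentMaps

variable {E : Type*} [NormedAddCommGroup E] [NormedSpace ℝ E] {H : Type*} [TopologicalSpace H]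
  {I : ModelWithCorners ℝ E H} {M : Type*} [TopologicalSpace M] [ChartedSpace H M]
  {E' : Type*} [NormedAddCommGroup E'] [NormedSpace ℝ E'] {H' : Type*} [TopologicalSpace H']
  {I' : ModelWithCorners ℝ E' H'} {N : Type*} [TopologicalSpace N] [ChartedSpace H' N]

theorem ContMDiffOn.contMDiffAt_tangentMap [IsManifold I 1 M] [IsManifold I' 1 N] {f : M → N}
    {W : Set M} (hf : ContMDiffOn I I' ∞ f W) (hW : IsOpen W) {v : TangentBundle I M}
    (hv : v.1 ∈ W) : ContMDiffAt I.tangent I'.tangent ∞ (tangentMap I I' f) v := by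
  have hpre : IsOpen (Bundle.TotalSpace.proj (F := E) (E := TangentSpace I (M := M)) ⁻¹' W) :=
    hW.preimage (FiberBundle.continuous_proj E (TangentSpace I (M := M)))
  have h := (hf.contMDiffOn_tangentMapWithin (m := ∞) (by rfl) hW.uniqueMDiffOn).contMDiffAt
    (hpre.mem_nhds hv)
  refine h.congr_of_eventuallyEq ?_
  filter_upwards [hpre.mem_nhds hv] with w hw
  simp only [tangentMap, tangentMapWithin]
  rw [mfderivWithin_of_isOpen hW hw]

/-- A smooth map sends smooth vector fields to smooth vector fields along the map. -/
theorem ContMDiffOn.contMDiffAt_mfderiv_section [IsManifold I 1 M] [IsManifold I' 1 N] {f : M → N}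
    {W : Set M} (hf : ContMDiffOn I I' ∞ f W) (hW : IsOpen W) {X : ∀ y : M, TangentSpace I y}
    {x : M} (hx : x ∈ W)
    (hX : ContMDiffAt I I.tangent ∞ (fun y => (⟨y, X y⟩ : TangentBundle I M)) x) :
    ContMDiffAt I I'.tangent ∞
      (fun y => (⟨f y, mfderiv I I' f y (X y)⟩ : TangentBundle I' N)) x :=
  ContMDiffAt.comp (g := tangentMap I I' f) (f := fun y => (⟨y, X y⟩ : TangentBundle I M)) x
    (hf.contMDiffAt_tangentMap hW hx) hX

/-- A smooth vector-valued function has smooth derivatives along smooth vector fields. -/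
theorem ContMDiffOn.contMDiffAt_mfderiv_apply [IsManifold I 1 M] {f : M → E'}
    {W : Set M} (hf : ContMDiffOn I 𝓘(ℝ, E') ∞ f W) (hW : IsOpen W)
    {X : ∀ y : M, TangentSpace I y} {x : M} (hx : x ∈ W)
    (hX : ContMDiffAt I I.tangent ∞ (fun y => (⟨y, X y⟩ : TangentBundle I M)) x) :
    ContMDiffAt I 𝓘(ℝ, E') ∞ (fun y => (mfderiv I 𝓘(ℝ, E') f y (X y) : E')) x :=
  ((contMDiff_snd_tangentBundle_modelSpace E' 𝓘(ℝ, E')).contMDiffAt).comp x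
    (hf.contMDiffAt_mfderiv_section hW hx hX)

/-- Smoothness of a vector field can be read off in a chart. -/
theorem contMDiffAt_vectorField_iff_mfderiv_chartAt {M : Type*} [TopologicalSpace M]
    [ChartedSpace E M] [IsManifold 𝓘(ℝ, E) ∞ M] {X : ∀ y : M, TangentSpace 𝓘(ℝ, E) y} {x₀ x : M}
    (hx : x ∈ (chartAt E x₀).source) :
    ContMDiffAt 𝓘(ℝ, E) 𝓘(ℝ, E).tangent ∞
        (fun y => (⟨y, X y⟩ : TangentBundle 𝓘(ℝ, E) M)) x ↔
      ContMDiffAt 𝓘(ℝ, E) 𝓘(ℝ, E) ∞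
        (fun y => (mfderiv 𝓘(ℝ, E) 𝓘(ℝ, E) (chartAt E x₀) y (X y) : E)) x := by
  have hb : x ∈ (trivializationAt E (TangentSpace 𝓘(ℝ, E)) x₀).baseSet := by simpa using hx
  have hext : ⇑(extChartAt 𝓘(ℝ, E) x₀) = chartAt E x₀ := by simp [mfld_simps]
  have : IsManifold 𝓘(ℝ, E) 1 M := .of_le (n := ∞) (by norm_cast)
  refine ((trivializationAt E (TangentSpace 𝓘(ℝ, E)) x₀).contMDiffAt_section_iff hb).trans
    (Filter.EventuallyEq.contMDiffAt_iff ?_)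
  filter_upwards [(chartAt E x₀).open_source.mem_nhds hx] with y hy
  have h := congrArg (fun f : E →L[ℝ] E => f (X y))
    (TangentBundle.continuousLinearMapAt_trivializationAt (I := 𝓘(ℝ, E)) hy)
  rw [hext] at h
  refine Eq.trans (Eq.symm ?_) h
  -- The trivialization of the tangent bundle at `x₀` is the derivative of the preferred chart at
  -- `x₀`. This is why the criterion is stated for `chartAt` and not for an arbitrary chart of the
  -- atlas.
  change (trivializationAt E (TangentSpace 𝓘(ℝ, E)) x₀).continuousLinearMapAt ℝ y (X y) = _
  rw [Bundle.Trivialization.continuousLinearMapAt_apply, Bundle.Trivialization.linearMapAt_apply,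
    if_pos (by simpa using hy)]

end TangentMaps

namespace AlmostCRStructure

/-! ### Derivatives of the projection and of the fibre coordinates -/

section ProjCalculus

variable {E : Type*} [NormedAddCommGroup E] [NormedSpace ℝ E] [FiniteDimensional ℝ E]
  {M : Type*} [TopologicalSpace M] [ChartedSpace E M] [IsManifold 𝓘(ℝ, E) ∞ M] {d : ℕ}
  {S : AlmostCRStructure 𝓘(ℝ, E) M d}

variable (S) in
/-- The data of a chart in the atlas of `ℙHM`. -/
abbrev StdChartData : Type _ := S.ProjChartData ((finrank ℝ E - d) / 2 - 1)

/-- The vector space on which the fibres of `ℙHM` are modelled. -/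
abbrev ProjFibreModel (E : Type*) [NormedAddCommGroup E] [NormedSpace ℝ E] (d : ℕ) : Type :=
  Fin ((finrank ℝ E - d) / 2 - 1) → ℂ

theorem ProjChartData.chart_mem_atlas (D : S.StdChartData) (p : S.Proj) :
    D.chart p ∈ atlas (ProjModel E d) S.Proj := ⟨D, p, rfl⟩

theorem Proj.exists_chartAt_eq (q : S.Proj) :
    ∃ (D : S.StdChartData), chartAt (ProjModel E d) q = D.chart q :=
  ⟨(Proj.exists_chart q).choose, rfl⟩

theorem ProjChartData.contMDiffOn_chart (D : S.StdChartData) (p : S.Proj) :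
    ContMDiffOn 𝓘(ℝ, ProjModel E d) 𝓘(ℝ, ProjModel E d) ∞ (D.chart p) (D.chart p).source :=
  contMDiffOn_of_mem_maximalAtlas (IsManifold.subset_maximalAtlas (D.chart_mem_atlas p))

theorem ProjChartData.contMDiffOn_affineCoords (D : S.StdChartData) :
    ContMDiffOn 𝓘(ℝ, ProjModel E d) 𝓘(ℝ, ProjFibreModel E d) ∞ (S.affineCoords D.s)
      (S.affineSource D.s D.U) := by
  intro q hq
  exact contDiff_snd.contMDiff.contMDiffAt.comp_contMDiffWithinAt
    (f := D.chart q) (g := Prod.snd) q (D.contMDiffOn_chart q q hq)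

theorem Proj.contMDiff_pr : ContMDiff 𝓘(ℝ, ProjModel E d) 𝓘(ℝ, E) ∞ (Proj.pr S) := by
  intro q
  obtain ⟨D, hD⟩ := Proj.exists_chart q
  have hU := D.pr_mem_of_mem_source hD
  have h1 : ContMDiffAt 𝓘(ℝ, ProjModel E d) 𝓘(ℝ, E) ∞ (fun r => D.e (Proj.pr S r)) q :=
    contDiff_fst.contMDiff.contMDiffAt.comp (f := D.chart q) (g := Prod.fst) q
      ((D.contMDiffOn_chart q).contMDiffAt ((D.chart q).open_source.mem_nhds hD))
  have h2 : ContMDiffAt 𝓘(ℝ, E) 𝓘(ℝ, E) ∞ D.e.symm (D.e (Proj.pr S q)) :=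
    contMDiffAt_symm_of_mem_maximalAtlas
      (IsManifold.subset_maximalAtlas (I := 𝓘(ℝ, E)) (n := ∞) D.mem_atlas)
      (D.e.map_source (D.subset_source hU))
  -- Near `q`, `Pr` is the first chart component followed by the inverse chart of `M`.
  refine (h2.comp q h1).congr_of_eventuallyEq ?_
  filter_upwards [(D.chart q).open_source.mem_nhds hD] with r hr
  exact (D.e.left_inv (D.subset_source (D.pr_mem_of_mem_source hr))).symm

variable (S) in
/-- The derivative of the projection `ℙHM → M`. -/
noncomputable def prDeriv (q : S.Proj) :
    TangentSpace 𝓘(ℝ, ProjModel E d) q →L[ℝ] TangentSpace 𝓘(ℝ, E) (Proj.pr S q) :=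
  mfderiv 𝓘(ℝ, ProjModel E d) 𝓘(ℝ, E) (Proj.pr S) q

/-- The derivative of the affine fibre coordinates of a standard chart. -/
noncomputable def ProjChartData.fibreDeriv (D : S.StdChartData) (q : S.Proj) :
    TangentSpace 𝓘(ℝ, ProjModel E d) q →L[ℝ] ProjFibreModel E d :=
  mfderiv 𝓘(ℝ, ProjModel E d) 𝓘(ℝ, ProjFibreModel E d) (S.affineCoords D.s) q

theorem ProjChartData.mfderiv_chart_apply (D : S.StdChartData) (p : S.Proj) {q : S.Proj}
    (hq : q ∈ S.affineSource D.s D.U) (v : TangentSpace 𝓘(ℝ, ProjModel E d) q) :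
    (mfderiv 𝓘(ℝ, ProjModel E d) 𝓘(ℝ, ProjModel E d) (D.chart p) q v : ProjModel E d) =
      ((mfderiv 𝓘(ℝ, E) 𝓘(ℝ, E) D.e (Proj.pr S q) (S.prDeriv q v) : E), D.fibreDeriv q v) := by
  have hpr := (Proj.contMDiff_pr (S := S) q).mdifferentiableAt (by simp)
  have : IsManifold 𝓘(ℝ, E) 1 M := .of_le (n := ∞) (by norm_cast)
  have he := mdifferentiableAt_atlas (I := 𝓘(ℝ, E)) D.mem_atlas
    (D.subset_source (D.pr_mem_of_mem_source hq))
  have hz := (D.contMDiffOn_affineCoords.contMDiffAt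
    (D.isOpen_source.mem_nhds hq)).mdifferentiableAt (by simp)
  have h := (he.hasMFDerivAt.comp q hpr.hasMFDerivAt)
  have h' := hz.hasMFDerivAt
  have h2 : HasMFDerivAt 𝓘(ℝ, ProjModel E d) 𝓘(ℝ, ProjModel E d)
    (fun r => (D.e (Proj.pr S r), S.affineCoords D.s r)) q _ :=
    ⟨h.1.prodMk h'.1, h.2.prodMk h'.2⟩
  exact congrArg (fun f : ProjModel E d →L[ℝ] ProjModel E d => f v) h2.mfderiv

/-- The derivatives of the projection and of the affine fibre coordinates, taken together. -/
noncomputable def ProjChartData.split (D : S.StdChartData) (q : S.Proj) :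
    TangentSpace 𝓘(ℝ, ProjModel E d) q →ₗ[ℝ]
      TangentSpace 𝓘(ℝ, E) (Proj.pr S q) × ProjFibreModel E d :=
  (S.prDeriv q : _ →ₗ[ℝ] _).prod (D.fibreDeriv q : _ →ₗ[ℝ] _)

@[simp] theorem ProjChartData.split_apply (D : S.StdChartData) (q : S.Proj)
    (v : TangentSpace 𝓘(ℝ, ProjModel E d) q) :
    D.split q v = (S.prDeriv q v, D.fibreDeriv q v) := rfl

/-- Composing the first component with the derivative of `D.e` gives the derivative of the chart of
`ℙHM`, which is injective; surjectivity follows by counting dimensions. -/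
theorem ProjChartData.split_bijective (D : S.StdChartData) {q : S.Proj}
    (hq : q ∈ S.affineSource D.s D.U) : Function.Bijective (D.split q) := by
  have : FiniteDimensional ℝ (TangentSpace 𝓘(ℝ, ProjModel E d) q) :=
    inferInstanceAs (FiniteDimensional ℝ (ProjModel E d))
  have : FiniteDimensional ℝ (TangentSpace 𝓘(ℝ, E) (Proj.pr S q)) :=
    inferInstanceAs (FiniteDimensional ℝ E)
  have hinj : Function.Injective (D.split q) := by
    refine (injective_iff_map_eq_zero _).2 fun v hv => ?_
    rw [split_apply, Prod.mk_eq_zero] at hv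
    have : IsManifold 𝓘(ℝ, ProjModel E d) 1 S.Proj := .of_le (n := ∞) (by norm_cast)
    have h := (mdifferentiable_of_mem_atlas (I := 𝓘(ℝ, ProjModel E d))
      (D.chart_mem_atlas q)).mfderiv_injective (x := q) hq
    refine h ?_
    have h0 := D.mfderiv_chart_apply q hq v
    rw [hv.1, hv.2, map_zero] at h0
    rw [map_zero]
    exact h0
  refine ⟨hinj, (LinearMap.injective_iff_surjective_of_finrank_eq_finrank ?_).1 hinj⟩
  -- The tangent spaces unfold to their models, so both sides are the dimension of `E ×
  -- ProjFibreModel E d`.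
  exact rfl

end ProjCalculus

/-! ### The local complex structures and their agreement on vertical vectors -/

section ProjCR

variable {E : Type*} [NormedAddCommGroup E] [NormedSpace ℝ E] [FiniteDimensional ℝ E]
  {M : Type*} [TopologicalSpace M] [ChartedSpace E M] [IsManifold 𝓘(ℝ, E) ∞ M] {d : ℕ}
  {S : AlmostCRStructure 𝓘(ℝ, E) M d}

/-- On vertical vectors, the derivatives of the fibre coordinates of two standard charts differ by
a complex linear map. -/
theorem ProjChartData.exists_complexLinear_fibreDeriv (D D' : S.StdChartData) {q : S.Proj}
    (hq : q ∈ S.affineSource D.s D.U) (hq' : q ∈ S.affineSource D'.s D'.U) :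
    ∃ L : ProjFibreModel E d →L[ℂ] ProjFibreModel E d,
      ∀ v, S.prDeriv q v = 0 → D'.fibreDeriv q v = L (D.fibreDeriv q v) := by
  have : IsManifold 𝓘(ℝ, ProjModel E d) 1 S.Proj := .of_le (n := ∞) (by norm_cast)
  let u : E := D.e (Proj.pr S q)
  let z₀ : ProjFibreModel E d := S.affineCoords D.s q
  have hqc : (D.chart q).symm (u, z₀) = q := (D.chart q).left_inv hq
  have htgt : (u, z₀) ∈ (D.chart q).target := (D.chart q).map_source hq
  let y : M := D.e.symm u
  have hy : y ∈ D.U := htgt.2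
  have hinv : ∀ z : ProjFibreModel E d, (D.chart q).symm (u, z) =
      Proj.mk S (NonzeroVec.mk S y _ (D.frame.comb_affinePoint_ne_zero hy z)) := fun z =>
    D.inv_of_mem q (q := (u, z)) hy
  -- The change of frame in the fixed fibre over `y`, complex linear because both frames use the
  -- action of `ℂ` through `J`.
  let A : (Option (Fin ((finrank ℝ E - d) / 2 - 1)) → ℂ) →ₗ[ℂ]
      (Option (Fin ((finrank ℝ E - d) / 2 - 1)) → ℂ) :=
    { toFun := fun c => S.coords D'.s y (S.comb D.s y c)
      map_add' := fun c c' => by simp only [map_add]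
      map_smul' := fun z c => by rw [comb_smul, coords_act, RingHom.id_apply] }
  have hA0 : A (affinePoint z₀) none ≠ 0 := by
    rw [← hqc, hinv, mk_mem_affineSource] at hq'
    exact hq'.2
  have haff : DifferentiableAt ℂ (fun z : ProjFibreModel E d => affinePoint z) z₀ := by
    refine differentiableAt_pi.2 fun a => ?_
    cases a with
    | none => exact differentiableAt_const (c := (1 : ℂ))
    | some i => exact differentiableAt_apply i z₀
  have hAaff : ∀ a, DifferentiableAt ℂ (fun z : ProjFibreModel E d => A (affinePoint z) a) z₀ :=
    differentiableAt_pi.1 ((LinearMap.toContinuousLinearMap A).differentiableAt.comp z₀ haff)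
  -- The transition of affine coordinates on one fibre: a quotient of complex affine functions of
  -- `z`. Its denominator is nonzero at `z₀` because `q` lies in the domain of `D'`.
  let ψ : ProjFibreModel E d → ProjFibreModel E d := fun z =>
    S.affineCoords D'.s ((D.chart q).symm (u, z))
  have hψ : DifferentiableAt ℂ ψ z₀ := by
    have : ψ = fun z i => A (affinePoint z) (some i) / A (affinePoint z) none := by
      funext z
      simp only [ψ, hinv]
      rfl
    rw [this]
    refine differentiableAt_pi.2 fun i => ?_
    have h := (hAaff none).inv hA0
    exact (hAaff (some i)).mul h
  have hmd := mdifferentiable_of_mem_atlas (I := 𝓘(ℝ, ProjModel E d)) (D.chart_mem_atlas q)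
  have hsymm := (hmd.mdifferentiableAt_symm htgt).hasMFDerivAt
  have hz := ((D'.contMDiffOn_affineCoords.contMDiffAt
    (D'.isOpen_source.mem_nhds hq')).mdifferentiableAt (by simp)).hasMFDerivAt
  -- Stating the derivative on the model space, to which every tangent space unfolds, allows its
  -- base point to be rewritten along `hqc`.
  let T : ProjModel E d →L[ℝ] ProjFibreModel E d := D'.fibreDeriv q
  have hz' : HasMFDerivAt 𝓘(ℝ, ProjModel E d) 𝓘(ℝ, ProjFibreModel E d) (S.affineCoords D'.s)
      ((D.chart q).symm (u, z₀)) T := by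
    rw [hqc]
    exact hz
  have hright : HasFDerivAt (𝕜 := ℝ) (fun z : ProjFibreModel E d => (u, z))
      (ContinuousLinearMap.inr ℝ E (ProjFibreModel E d)) z₀ := hasFDerivAt_prodMk_right u z₀
  have hinr : HasMFDerivAt 𝓘(ℝ, ProjFibreModel E d) 𝓘(ℝ, ProjModel E d)
      (fun z : ProjFibreModel E d => ((u, z) : ProjModel E d)) z₀
      (ContinuousLinearMap.inr ℝ E (ProjFibreModel E d)) :=
    hasMFDerivAt_iff_hasFDerivAt.2 hright
  have hcomp := (hz'.comp (u, z₀) hsymm).comp z₀ hinr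
  have hfd : HasFDerivAt (𝕜 := ℝ) ψ _ z₀ := hcomp.hasFDerivAt
  -- The chain rule through the inverse chart and the complex derivative of `ψ` give the same real
  -- derivative, which is thus complex linear.
  have huniq := hfd.unique (hψ.hasFDerivAt.restrictScalars ℝ)
  refine ⟨fderiv ℂ ψ z₀, fun v hv => ?_⟩
  -- A vertical vector has no base component in the chart, so it is tangent to the slice `z ↦ (u,
  -- z)` on which `ψ` is defined.
  have h1 : (mfderiv 𝓘(ℝ, ProjModel E d) 𝓘(ℝ, ProjModel E d) (D.chart q) q v : ProjModel E d) =
      (0, D.fibreDeriv q v) := by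
    rw [D.mfderiv_chart_apply q hq, hv, map_zero]; rfl
  have h2 := congrArg (fun f : ProjModel E d →L[ℝ] ProjModel E d => f v)
    (hmd.symm_comp_deriv (x := q) hq)
  have h3 := congrArg (fun f : ProjFibreModel E d →L[ℝ] ProjFibreModel E d => f (D.fibreDeriv q v))
    huniq
  refine Eq.trans ?_ h3
  refine congrArg T (Eq.trans h2.symm ?_)
  exact congrArg (mfderiv 𝓘(ℝ, ProjModel E d) 𝓘(ℝ, ProjModel E d) (D.chart q).symm (u, z₀) :
    ProjModel E d →L[ℝ] ProjModel E d) h1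

/-- The pullback of the Levi distribution to `ℙHM`. -/
noncomputable def projHM (S : AlmostCRStructure 𝓘(ℝ, E) M d) (q : S.Proj) :
    Submodule ℝ (TangentSpace 𝓘(ℝ, ProjModel E d) q) :=
  (S.HM (Proj.pr S q)).comap (S.prDeriv q : _ →ₗ[ℝ] _)

/-- The derivative of the projection, from the pullback distribution to the Levi distribution. -/
noncomputable def prHM (S : AlmostCRStructure 𝓘(ℝ, E) M d) (q : S.Proj) :
    S.projHM q →ₗ[ℝ] S.HM (Proj.pr S q) :=
  (S.prDeriv q : _ →ₗ[ℝ] _).restrict fun _ hv => hv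

@[simp] theorem coe_prHM (q : S.Proj) (v : S.projHM q) :
    (S.prHM q v : TangentSpace 𝓘(ℝ, E) (Proj.pr S q)) = S.prDeriv q v := rfl

/-- The splitting of the pullback distribution induced by a standard chart. -/
noncomputable def ProjChartData.splitHM (D : S.StdChartData) (q : S.Proj) :
    S.projHM q →ₗ[ℝ] S.HM (Proj.pr S q) × ProjFibreModel E d :=
  (S.prHM q).prod ((D.fibreDeriv q : _ →ₗ[ℝ] _) ∘ₗ (S.projHM q).subtype)

@[simp] theorem ProjChartData.splitHM_apply (D : S.StdChartData) (q : S.Proj) (v : S.projHM q) :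
    D.splitHM q v = (S.prHM q v, D.fibreDeriv q v) := rfl

theorem ProjChartData.splitHM_bijective (D : S.StdChartData) {q : S.Proj}
    (hq : q ∈ S.affineSource D.s D.U) : Function.Bijective (D.splitHM q) := by
  refine ⟨fun v w h => Subtype.ext ((D.split_bijective hq).1 ?_), fun ⟨w, z⟩ => ?_⟩
  · rw [splitHM_apply, splitHM_apply, Prod.mk.injEq] at h
    rw [split_apply, split_apply, ← coe_prHM, ← coe_prHM, h.1, h.2]
  · obtain ⟨v, hv⟩ := (D.split_bijective hq).2 (w, z)
    rw [split_apply, Prod.mk.injEq] at hv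
    refine ⟨⟨v, ?_⟩, Prod.ext (Subtype.ext hv.1) hv.2⟩
    change S.prDeriv q v ∈ S.HM _
    rw [hv.1]
    exact w.2

open Classical in
/-- The inverse of `splitHM` (zero outside the domain of the chart). -/
noncomputable def ProjChartData.lift (D : S.StdChartData) (q : S.Proj) :
    S.HM (Proj.pr S q) × ProjFibreModel E d →ₗ[ℝ] S.projHM q :=
  if h : Function.Bijective (D.splitHM q) then (LinearEquiv.ofBijective _ h).symm else 0

theorem ProjChartData.splitHM_lift (D : S.StdChartData) {q : S.Proj}
    (hq : q ∈ S.affineSource D.s D.U) (w : S.HM (Proj.pr S q) × ProjFibreModel E d) :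
    D.splitHM q (D.lift q w) = w := by
  rw [lift, dif_pos (D.splitHM_bijective hq)]
  exact (LinearEquiv.ofBijective _ (D.splitHM_bijective hq)).apply_symm_apply w

theorem ProjChartData.lift_splitHM (D : S.StdChartData) {q : S.Proj}
    (hq : q ∈ S.affineSource D.s D.U) (v : S.projHM q) :
    D.lift q (D.splitHM q v) = v :=
  (D.splitHM_bijective hq).1 (D.splitHM_lift hq _)

theorem ProjChartData.lift_bijective (D : S.StdChartData) {q : S.Proj}
    (hq : q ∈ S.affineSource D.s D.U) : Function.Bijective (D.lift q) :=
  Function.bijective_iff_has_inverse.2 ⟨D.splitHM q, D.splitHM_lift hq, D.lift_splitHM hq⟩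

theorem ProjChartData.prHM_lift (D : S.StdChartData) {q : S.Proj}
    (hq : q ∈ S.affineSource D.s D.U) (w : S.HM (Proj.pr S q)) (z : ProjFibreModel E d) :
    S.prHM q (D.lift q (w, z)) = w := congrArg Prod.fst (D.splitHM_lift hq (w, z))

theorem ProjChartData.fibreDeriv_lift (D : S.StdChartData) {q : S.Proj}
    (hq : q ∈ S.affineSource D.s D.U) (w : S.HM (Proj.pr S q)) (z : ProjFibreModel E d) :
    D.fibreDeriv q (D.lift q (w, z)) = z := congrArg Prod.snd (D.splitHM_lift hq (w, z))

/-- The product of the complex structure `J` of `HM` and the one of the fibres of `ℙHM`, in the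
splitting given by a standard chart. -/
noncomputable def ProjChartData.localJ (D : S.StdChartData) (q : S.Proj) :
    S.projHM q →ₗ[ℝ] S.projHM q :=
  D.lift q ∘ₗ ((S.J (Proj.pr S q)).prodMap (Complex.I • LinearMap.id)) ∘ₗ D.splitHM q

theorem ProjChartData.localJ_apply (D : S.StdChartData) (q : S.Proj) (v : S.projHM q) :
    D.localJ q v =
      D.lift q (S.J (Proj.pr S q) (S.prHM q v), Complex.I • D.fibreDeriv q v) := rfl

theorem ProjChartData.prHM_localJ (D : S.StdChartData) {q : S.Proj}
    (hq : q ∈ S.affineSource D.s D.U) (v : S.projHM q) :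
    S.prHM q (D.localJ q v) = S.J _ (S.prHM q v) := by
  rw [localJ_apply, D.prHM_lift hq]

theorem ProjChartData.fibreDeriv_localJ (D : S.StdChartData) {q : S.Proj}
    (hq : q ∈ S.affineSource D.s D.U) (v : S.projHM q) :
    D.fibreDeriv q (D.localJ q v) = Complex.I • D.fibreDeriv q v := by
  rw [localJ_apply, D.fibreDeriv_lift hq]

theorem ProjChartData.localJ_localJ (D : S.StdChartData) {q : S.Proj}
    (hq : q ∈ S.affineSource D.s D.U) (v : S.projHM q) :
    D.localJ q (D.localJ q v) = -v := by
  refine (D.splitHM_bijective hq).1 ?_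
  rw [map_neg, splitHM_apply, splitHM_apply, D.prHM_localJ hq, D.prHM_localJ hq,
    D.fibreDeriv_localJ hq, D.fibreDeriv_localJ hq, S.J_J, smul_smul, Complex.I_mul_I]
  simp

/-- On vertical vectors each local structure is multiplication by `i` in affine coordinates, and the
change of coordinates commutes with `i`. -/
theorem ProjChartData.localJ_eq_of_prHM_eq_zero (D D' : S.StdChartData) {q : S.Proj}
    (hq : q ∈ S.affineSource D.s D.U) (hq' : q ∈ S.affineSource D'.s D'.U) {v : S.projHM q}
    (hv : S.prHM q v = 0) : D'.localJ q v = D.localJ q v := by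
  obtain ⟨L, hL⟩ := D.exists_complexLinear_fibreDeriv D' hq hq'
  have h0 : ∀ w : S.projHM q, S.prHM q w = 0 → S.prDeriv q w = 0 := fun w hw =>
    congrArg Subtype.val hw
  -- The image of `v` is vertical too, so the complex linear map `L` applies both to it and to `v`.
  have hJ : S.prHM q (D.localJ q v) = 0 := by rw [D.prHM_localJ hq, hv, map_zero]
  refine (D'.splitHM_bijective hq').1 ?_
  rw [splitHM_apply, splitHM_apply, D'.prHM_localJ hq', hJ, hv, map_zero,
    D'.fibreDeriv_localJ hq', hL _ (h0 _ hJ), D.fibreDeriv_localJ hq, map_smul, hL _ (h0 _ hv)]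

end ProjCR

/-! ### Smooth sections of `HM` along a map -/

section SectionsAlongMaps

variable {E : Type*} [NormedAddCommGroup E] [NormedSpace ℝ E]
  {H : Type*} [TopologicalSpace H] {I : ModelWithCorners ℝ E H}
  {M : Type*} [TopologicalSpace M] [ChartedSpace H M] [IsManifold I ∞ M] {d : ℕ}
  {S : AlmostCRStructure I M d}
  {F : Type*} [NormedAddCommGroup F] [NormedSpace ℝ F]
  {G : Type*} [TopologicalSpace G] {K : ModelWithCorners ℝ F G}
  {N : Type*} [TopologicalSpace N] [ChartedSpace G N]
  {ι : Type*} [Fintype ι] {s : ι → ∀ y : M, S.HM y} {U : Set M} {g : N → M} {p : N}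

/-- Smooth combinations of a smooth frame are smooth along smooth maps. -/
theorem IsComplexFrameOn.contMDiffAt_comb (hs : S.IsComplexFrameOn s U)
    (hg : ContMDiffAt K I ∞ g p) (hp : g p ∈ U) {c : N → ι → ℂ}
    (hc : ContMDiffAt K 𝓘(ℝ, ι → ℂ) ∞ c p) :
    ContMDiffAt K I.tangent ∞ (fun q =>
      (⟨g q, (S.comb s (g q) (c q) : TangentSpace I (g q))⟩ : TangentBundle I M)) p := by
  refine Bundle.contMDiffAt_totalSpace.2 ⟨hg, ?_⟩
  have hT := (IsComplexFrameOn.contMDiffAt_combTriv hs.isOpen hs.smooth hp).comp p hg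
  refine (hT.clm_apply hc).congr_of_eventuallyEq ?_
  have hb := FiberBundle.mem_baseSet_trivializationAt' (F := E) (E := TangentSpace I) (g p)
  filter_upwards [hg.continuousAt
    ((trivializationAt E (TangentSpace I) (g p)).open_baseSet.mem_nhds hb)] with q hq
  exact (combTriv_apply S s hq _).symm

/-- The coordinates, in a smooth frame, of a smooth section along a map are smooth. -/
theorem IsComplexFrameOn.contMDiffAt_coords [FiniteDimensional ℝ E] (hs : S.IsComplexFrameOn s U)
    (hp : g p ∈ U) {w : ∀ q, S.HM (g q)} (hw : ContMDiffAt K I.tangent ∞ (fun q =>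
      (⟨g q, (w q : TangentSpace I (g q))⟩ : TangentBundle I M)) p) :
    ContMDiffAt K 𝓘(ℝ, ι → ℂ) ∞ (fun q => S.coords s (g q) (w q)) p := by
  obtain ⟨hg, hw⟩ := Bundle.contMDiffAt_totalSpace.1 hw
  obtain ⟨A, hA, hAc⟩ := hs.exists_coords hp
  refine ((hA.comp p hg).clm_apply hw).congr_of_eventuallyEq ?_
  filter_upwards [ContMDiffAt.continuousAt hg hAc] with q hq
  exact hq (w q)

theorem act_I (x : M) (v : S.HM x) : S.act x Complex.I v = S.J x v := by
  simp [act_apply]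

/-- The bundle map `J` preserves smoothness of sections along maps. -/
theorem IsComplexFrameOn.contMDiffAt_J [FiniteDimensional ℝ E] (hs : S.IsComplexFrameOn s U)
    (hp : g p ∈ U) {w : ∀ q, S.HM (g q)} (hw : ContMDiffAt K I.tangent ∞ (fun q =>
      (⟨g q, (w q : TangentSpace I (g q))⟩ : TangentBundle I M)) p) :
    ContMDiffAt K I.tangent ∞ (fun q =>
      (⟨g q, (S.J (g q) (w q) : TangentSpace I (g q))⟩ : TangentBundle I M)) p := by
  have hg : ContMDiffAt K I ∞ g p := (Bundle.contMDiffAt_totalSpace.1 hw).1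
  -- The field `smooth_J` only concerns sections over `M`. For sections along `g`, `J` becomes
  -- multiplication by `i` on the coordinates in a frame.
  have hc := (contDiff_const_smul (𝕜 := ℝ) (n := ∞) (F := ι → ℂ)
    Complex.I).contMDiff.contMDiffAt.comp p (hs.contMDiffAt_coords hp hw)
  refine (hs.contMDiffAt_comb hg hp hc).congr_of_eventuallyEq ?_
  filter_upwards [hg.continuousAt (hs.isOpen.mem_nhds hp)] with q hq
  simp only [Function.comp_apply]
  rw [comb_smul, comb_coords (hs.bijective _ hq), act_I]

end SectionsAlongMaps

/-! ### Smoothness, local frames and rank of the pullback distribution -/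

section ProjCR

variable {E : Type*} [NormedAddCommGroup E] [NormedSpace ℝ E] [FiniteDimensional ℝ E]
  {M : Type*} [TopologicalSpace M] [ChartedSpace E M] [IsManifold 𝓘(ℝ, E) ∞ M] {d : ℕ}
  {S : AlmostCRStructure 𝓘(ℝ, E) M d}

theorem contMDiffAt_prDeriv {X : ∀ q : S.Proj, TangentSpace 𝓘(ℝ, ProjModel E d) q} {q : S.Proj}
    (hX : ContMDiffAt 𝓘(ℝ, ProjModel E d) 𝓘(ℝ, ProjModel E d).tangent ∞
      (fun r => (⟨r, X r⟩ : TangentBundle 𝓘(ℝ, ProjModel E d) S.Proj)) q) :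
    ContMDiffAt 𝓘(ℝ, ProjModel E d) 𝓘(ℝ, E).tangent ∞
      (fun r => (⟨Proj.pr S r, S.prDeriv r (X r)⟩ : TangentBundle 𝓘(ℝ, E) M)) q :=
  have : IsManifold 𝓘(ℝ, ProjModel E d) 1 S.Proj := .of_le (n := ∞) (by norm_cast)
  have : IsManifold 𝓘(ℝ, E) 1 M := .of_le (n := ∞) (by norm_cast)
  Proj.contMDiff_pr.contMDiffOn.contMDiffAt_mfderiv_section isOpen_univ (Set.mem_univ q) hX

theorem ProjChartData.contMDiffAt_fibreDeriv (D : S.StdChartData)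
    {X : ∀ q : S.Proj, TangentSpace 𝓘(ℝ, ProjModel E d) q} {q : S.Proj}
    (hq : q ∈ S.affineSource D.s D.U)
    (hX : ContMDiffAt 𝓘(ℝ, ProjModel E d) 𝓘(ℝ, ProjModel E d).tangent ∞
      (fun r => (⟨r, X r⟩ : TangentBundle 𝓘(ℝ, ProjModel E d) S.Proj)) q) :
    ContMDiffAt 𝓘(ℝ, ProjModel E d) 𝓘(ℝ, ProjFibreModel E d) ∞
      (fun r => D.fibreDeriv r (X r)) q :=
  have : IsManifold 𝓘(ℝ, ProjModel E d) 1 S.Proj := .of_le (n := ∞) (by norm_cast)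
  D.contMDiffOn_affineCoords.contMDiffAt_mfderiv_apply D.isOpen_source hq hX

/-- In the chart, a vector field on `ℙHM` has as components its projection, read in the chart of
`M`, and its fibre derivative. This reduces smoothness on `ℙHM` to sections along `Pr` and
vector-valued functions, the two data by which `localJ` and `lift` are described. -/
theorem ProjChartData.contMDiffAt_vectorField (D : S.StdChartData) {q₀ : S.Proj}
    (hD : chartAt (ProjModel E d) q₀ = D.chart q₀)
    {X : ∀ q : S.Proj, TangentSpace 𝓘(ℝ, ProjModel E d) q} {q : S.Proj}
    (hq : q ∈ S.affineSource D.s D.U)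
    (hpr : ContMDiffAt 𝓘(ℝ, ProjModel E d) 𝓘(ℝ, E).tangent ∞
      (fun r => (⟨Proj.pr S r, S.prDeriv r (X r)⟩ : TangentBundle 𝓘(ℝ, E) M)) q)
    (hfib : ContMDiffAt 𝓘(ℝ, ProjModel E d) 𝓘(ℝ, ProjFibreModel E d) ∞
      (fun r => D.fibreDeriv r (X r)) q) :
    ContMDiffAt 𝓘(ℝ, ProjModel E d) 𝓘(ℝ, ProjModel E d).tangent ∞
      (fun r => (⟨r, X r⟩ : TangentBundle 𝓘(ℝ, ProjModel E d) S.Proj)) q := by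
  have : IsManifold 𝓘(ℝ, E) 1 M := .of_le (n := ∞) (by norm_cast)
  refine (contMDiffAt_vectorField_iff_mfderiv_chartAt (x₀ := q₀) (by rw [hD]; exact hq)).2 ?_
  rw [hD]
  have he : ContMDiffOn 𝓘(ℝ, E) 𝓘(ℝ, E) ∞ D.e D.e.source :=
    contMDiffOn_of_mem_maximalAtlas (IsManifold.subset_maximalAtlas D.mem_atlas)
  have h1 := (he.contMDiffAt_tangentMap D.e.open_source
    (v := ⟨Proj.pr S q, S.prDeriv q (X q)⟩) (D.subset_source (D.pr_mem_of_mem_source hq)))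
  have h2 := (contMDiff_snd_tangentBundle_modelSpace E 𝓘(ℝ, E) (n := ∞)).contMDiffAt.comp q
    (ContMDiffAt.comp q (g := tangentMap 𝓘(ℝ, E) 𝓘(ℝ, E) D.e)
      (f := fun r => (⟨Proj.pr S r, S.prDeriv r (X r)⟩ : TangentBundle 𝓘(ℝ, E) M)) h1 hpr)
  refine (h2.prodMk_space hfib).congr_of_eventuallyEq ?_
  filter_upwards [D.isOpen_source.mem_nhds hq] with r hr
  exact D.mfderiv_chart_apply q₀ hr (X r)

theorem ProjChartData.contMDiffAt_localJ (D : S.StdChartData) {q₀ : S.Proj}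
    (hD : chartAt (ProjModel E d) q₀ = D.chart q₀) {X : ∀ q : S.Proj, S.projHM q} {q : S.Proj}
    (hq : q ∈ S.affineSource D.s D.U)
    (hX : ContMDiffAt 𝓘(ℝ, ProjModel E d) 𝓘(ℝ, ProjModel E d).tangent ∞
      (fun r => (⟨r, (X r : TangentSpace 𝓘(ℝ, ProjModel E d) r)⟩ :
        TangentBundle 𝓘(ℝ, ProjModel E d) S.Proj)) q) :
    ContMDiffAt 𝓘(ℝ, ProjModel E d) 𝓘(ℝ, ProjModel E d).tangent ∞
      (fun r => (⟨r, (D.localJ r (X r) : TangentSpace 𝓘(ℝ, ProjModel E d) r)⟩ :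
        TangentBundle 𝓘(ℝ, ProjModel E d) S.Proj)) q := by
  refine D.contMDiffAt_vectorField hD hq ?_ ?_
  · refine (D.frame.contMDiffAt_J (D.pr_mem_of_mem_source hq) (w := fun r => S.prHM r (X r))
      (contMDiffAt_prDeriv hX)).congr_of_eventuallyEq ?_
    filter_upwards [D.isOpen_source.mem_nhds hq] with r hr
    rw [← coe_prHM, D.prHM_localJ hr]
  · refine ((contDiff_const_smul (𝕜 := ℝ) (n := ∞) (F := ProjFibreModel E d)
      Complex.I).contMDiff.contMDiffAt.comp q
        (D.contMDiffAt_fibreDeriv hq hX)).congr_of_eventuallyEq ?_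
    filter_upwards [D.isOpen_source.mem_nhds hq] with r hr
    exact D.fibreDeriv_localJ hr (X r)

theorem ProjChartData.contMDiffAt_lift (D : S.StdChartData) {q₀ : S.Proj}
    (hD : chartAt (ProjModel E d) q₀ = D.chart q₀) {q : S.Proj}
    (hq : q ∈ S.affineSource D.s D.U)
    (c : Option (Fin ((finrank ℝ E - d) / 2 - 1)) → ℂ) (z : ProjFibreModel E d) :
    ContMDiffAt 𝓘(ℝ, ProjModel E d) 𝓘(ℝ, ProjModel E d).tangent ∞
      (fun r => (⟨r, (D.lift r (S.comb D.s (Proj.pr S r) c, z) :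
        TangentSpace 𝓘(ℝ, ProjModel E d) r)⟩ :
        TangentBundle 𝓘(ℝ, ProjModel E d) S.Proj)) q := by
  refine D.contMDiffAt_vectorField hD hq ?_ ?_
  · refine (D.frame.contMDiffAt_comb (Proj.contMDiff_pr q) (D.pr_mem_of_mem_source hq)
      (c := fun _ => c) contMDiffAt_const).congr_of_eventuallyEq ?_
    filter_upwards [D.isOpen_source.mem_nhds hq] with r hr
    rw [← coe_prHM, D.prHM_lift hr]
  · refine (contMDiffAt_const (c := z)).congr_of_eventuallyEq ?_
    filter_upwards [D.isOpen_source.mem_nhds hq] with r hr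
    exact D.fibreDeriv_lift hr _ _

/-- The trivialization of the pullback distribution induced by a standard chart. -/
noncomputable def ProjChartData.frameMap (D : S.StdChartData) (q : S.Proj) :
    (Option (Fin ((finrank ℝ E - d) / 2 - 1)) → ℂ) × ProjFibreModel E d →ₗ[ℝ] S.projHM q :=
  D.lift q ∘ₗ (S.comb D.s (Proj.pr S q)).prodMap LinearMap.id

theorem ProjChartData.frameMap_bijective (D : S.StdChartData) {q : S.Proj}
    (hq : q ∈ S.affineSource D.s D.U) : Function.Bijective (D.frameMap q) :=
  (D.lift_bijective hq).comp
    ((D.frame.bijective _ (D.pr_mem_of_mem_source hq)).prodMap Function.bijective_id)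

theorem exists_frame_projHM (q : S.Proj) : ∃ U : Set S.Proj, IsOpen U ∧ q ∈ U ∧
    ∃ s : Fin (finrank ℝ (S.projHM q)) → ∀ r : S.Proj, S.projHM r,
      (∀ i, ContMDiffOn 𝓘(ℝ, ProjModel E d) 𝓘(ℝ, ProjModel E d).tangent ∞
        (fun r => (⟨r, (s i r : TangentSpace 𝓘(ℝ, ProjModel E d) r)⟩ :
          TangentBundle 𝓘(ℝ, ProjModel E d) S.Proj)) U) ∧
      ∀ r ∈ U, LinearIndependent ℝ (fun i => s i r) ∧
        Submodule.span ℝ (Set.range fun i => s i r) = ⊤ := by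
  obtain ⟨D, hD⟩ := Proj.exists_chartAt_eq q
  have hq : q ∈ S.affineSource D.s D.U := by
    have := mem_chart_source (ProjModel E d) q
    rwa [hD] at this
  -- A real basis of the fixed model, indexed by the rank at `q`; `frameMap` carries it to a basis
  -- of the distribution at every point of the chart domain.
  let b := Module.finBasisOfFinrankEq ℝ
    ((Option (Fin ((finrank ℝ E - d) / 2 - 1)) → ℂ) × ProjFibreModel E d)
    (LinearEquiv.ofBijective _ (D.frameMap_bijective hq)).finrank_eq
  refine ⟨_, D.isOpen_source, hq, fun i r => D.frameMap r (b i), fun i r hr => ?_, fun r hr => ?_⟩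
  · exact (D.contMDiffAt_lift hD hr (b i).1 (b i).2).contMDiffWithinAt
  · let b' := b.map (LinearEquiv.ofBijective _ (D.frameMap_bijective hr))
    have hb' : (fun i => D.frameMap r (b i)) = b' := funext fun i => by simp [b']
    rw [hb']
    exact ⟨b'.linearIndependent, b'.span_eq⟩

/-- The fibre dimension is added to both the rank of the distribution and the dimension of the
manifold, so it cancels and its value plays no role. -/
theorem finrank_projHM (q : S.Proj) :
    finrank ℝ (S.projHM q) + d = finrank ℝ (TangentSpace 𝓘(ℝ, ProjModel E d) q) := by
  have : FiniteDimensional ℝ (TangentSpace 𝓘(ℝ, E) (Proj.pr S q)) :=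
    inferInstanceAs (FiniteDimensional ℝ E)
  obtain ⟨D, hD⟩ := Proj.exists_chart q
  have h1 := (LinearEquiv.ofBijective _ (D.splitHM_bijective hD)).finrank_eq
  have h2 := S.codim (Proj.pr S q)
  have h3 : finrank ℝ (TangentSpace 𝓘(ℝ, ProjModel E d) q) =
      finrank ℝ (TangentSpace 𝓘(ℝ, E) (Proj.pr S q)) + finrank ℝ (ProjFibreModel E d) :=
    Module.finrank_prod (R := ℝ) (M := E) (M' := ProjFibreModel E d)
  rw [Module.finrank_prod] at h1
  omega

end ProjCR

end AlmostCRStructure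

/-! ### Averaging complex structures -/

/-- An affine combination of complex structures which lift the same endomorphism and agree on the
kernel of the projection is a complex structure. -/
theorem sum_smul_complexStructure {V W ι : Type*} [AddCommGroup V] [Module ℝ V] [AddCommGroup W]
    [Module ℝ W] {t : Finset ι} {ρ : ι → ℝ} (hsum : ∑ i ∈ t, ρ i = 1) {p : V →ₗ[ℝ] W}
    {K : W →ₗ[ℝ] W} {J : ι → V →ₗ[ℝ] V} (hp : ∀ i ∈ t, ∀ v, p (J i v) = K (p v))
    (hJ : ∀ i ∈ t, ∀ v, J i (J i v) = -v)
    (hvert : ∀ i ∈ t, ∀ j ∈ t, ∀ v, p v = 0 → J i v = J j v) (v : V) :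
    (∑ i ∈ t, ρ i • J i) ((∑ i ∈ t, ρ i • J i) v) = -v := by
  obtain ⟨j, hj⟩ : t.Nonempty := Finset.nonempty_of_sum_ne_zero (hsum.trans_ne one_ne_zero)
  set J' := ∑ i ∈ t, ρ i • J i with hJ'
  have happly : ∀ w, J' w = ∑ i ∈ t, ρ i • J i w := fun w => by simp [hJ']
  have hp' : ∀ w, p (J' w) = K (p w) := fun w => by
    rw [happly, map_sum, Finset.sum_congr rfl fun i hi => by rw [map_smul, hp i hi],
      ← Finset.sum_smul, hsum, one_smul]
  have hvert' : ∀ w, p w = 0 → J' w = J j w := fun w hw => by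
    rw [happly, Finset.sum_congr rfl fun i hi => by rw [hvert i hi j hj w hw],
      ← Finset.sum_smul, hsum, one_smul]
  -- With `A = J i - J j` this is the linear form of the condition on `A`, namely `A J j + J j A =
  -- 0`. It comes from applying both structures to `J j v - J i v`, which lies in the kernel of `p`,
  -- and it survives averaging over `i`.
  have h1 : ∀ i ∈ t, J i (J j v) = -(2 : ℝ) • v - J j (J i v) := fun i hi => by
    have h2 := hvert i hi j hj (J j v - J i v) (by rw [map_sub, hp j hj, hp i hi, sub_self])
    rw [map_sub, map_sub, hJ i hi, hJ j hj] at h2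
    linear_combination (norm := module) h2
  have h2 : J' (J j v) = -(2 : ℝ) • v - J j (J' v) := by
    rw [happly, happly, Finset.sum_congr rfl fun i hi => by rw [h1 i hi]]
    simp only [smul_sub, Finset.sum_sub_distrib, ← Finset.sum_smul, hsum, one_smul, map_sum,
      map_smul]
  -- The same argument run backwards for `J'`: the averaged relation `h2` together with agreement on
  -- the kernel yields the square of `J'`.
  have h3 := hvert' (J' v - J j v) (by rw [map_sub, hp', hp j hj, sub_self])
  rw [map_sub, map_sub, h2, hJ j hj] at h3
  linear_combination (norm := module) h3

namespace AlmostCRStructure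

/-! ### Gluing with a partition of unity -/

section Gluing

variable {E : Type*} [NormedAddCommGroup E] [NormedSpace ℝ E] [FiniteDimensional ℝ E]
  {M : Type*} [TopologicalSpace M] [ChartedSpace E M] [IsManifold 𝓘(ℝ, E) ∞ M] {d : ℕ}
  {S : AlmostCRStructure 𝓘(ℝ, E) M d}

variable (S) in
/-- The data of the preferred chart of `ℙHM` at a point. -/
noncomputable def chartDataAt (q : S.Proj) : S.StdChartData :=
  (Proj.exists_chartAt_eq q).choose

theorem chartAt_eq_chartDataAt (q : S.Proj) :
    chartAt (ProjModel E d) q = (S.chartDataAt q).chart q :=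
  (Proj.exists_chartAt_eq q).choose_spec

/-- The complex structure on the pullback distribution glued from the local product structures by
means of a partition of unity. -/
noncomputable def gluedJ
    (f : SmoothPartitionOfUnity S.Proj 𝓘(ℝ, ProjModel E d) S.Proj Set.univ) (q : S.Proj) :
    S.projHM q →ₗ[ℝ] S.projHM q :=
  ∑ i ∈ f.finsupport q, f i q • (S.chartDataAt i).localJ q

variable {f : SmoothPartitionOfUnity S.Proj 𝓘(ℝ, ProjModel E d) S.Proj Set.univ}

theorem gluedJ_apply (q : S.Proj) (v : S.projHM q) :
    gluedJ f q v = ∑ i ∈ f.finsupport q, f i q • (S.chartDataAt i).localJ q v := by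
  simp [gluedJ]

/-- The index set `f.finsupport q` varies with `q`; a sum over all indices is the form to which
smoothness of locally finite sums of sections applies. -/
theorem gluedJ_eq_finsum (q : S.Proj) (v : S.projHM q) :
    (gluedJ f q v : TangentSpace 𝓘(ℝ, ProjModel E d) q) =
      ∑ᶠ i, f i q • ((S.chartDataAt i).localJ q v : TangentSpace 𝓘(ℝ, ProjModel E d) q) := by
  rw [finsum_eq_sum_of_support_subset (s := f.finsupport q), gluedJ_apply]
  · simp
  · intro i hi
    rw [f.coe_finsupport]
    exact fun h => hi (by simp only [h, zero_smul])

theorem mem_affineSource_of_mem_tsupport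
    (hf : f.IsSubordinate fun q => (chartAt (ProjModel E d) q).source) {i q : S.Proj}
    (hq : q ∈ tsupport (f i)) :
    q ∈ S.affineSource (S.chartDataAt i).s (S.chartDataAt i).U := by
  have h : q ∈ (chartAt (ProjModel E d) i).source := hf i hq
  rwa [chartAt_eq_chartDataAt] at h

theorem mem_affineSource_of_mem_finsupport
    (hf : f.IsSubordinate fun q => (chartAt (ProjModel E d) q).source) {i q : S.Proj}
    (hi : i ∈ f.finsupport q) :
    q ∈ S.affineSource (S.chartDataAt i).s (S.chartDataAt i).U :=
  mem_affineSource_of_mem_tsupport hf (subset_tsupport _ ((f.mem_finsupport q).1 hi))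

theorem prHM_gluedJ (hf : f.IsSubordinate fun q => (chartAt (ProjModel E d) q).source)
    (q : S.Proj) (v : S.projHM q) : S.prHM q (gluedJ f q v) = S.J _ (S.prHM q v) := by
  rw [gluedJ_apply, map_sum, Finset.sum_congr rfl fun i hi => by
    rw [map_smul, (S.chartDataAt i).prHM_localJ (mem_affineSource_of_mem_finsupport hf hi)],
    ← Finset.sum_smul, f.sum_finsupport q (Set.mem_univ q), one_smul]

/-- Subordination makes every chart with nonzero weight at `q` contain `q`, so only genuine local
structures enter the average. -/
theorem gluedJ_gluedJ (hf : f.IsSubordinate fun q => (chartAt (ProjModel E d) q).source)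
    (q : S.Proj) (v : S.projHM q) : gluedJ f q (gluedJ f q v) = -v := by
  have hmem := fun i (hi : i ∈ f.finsupport q) => mem_affineSource_of_mem_finsupport hf hi
  exact sum_smul_complexStructure (f.sum_finsupport q (Set.mem_univ q))
    (fun i hi => (S.chartDataAt i).prHM_localJ (hmem i hi))
    (fun i hi => (S.chartDataAt i).localJ_localJ (hmem i hi))
    (fun i hi j hj _ => ProjChartData.localJ_eq_of_prHM_eq_zero _ _ (hmem j hj) (hmem i hi)) v

theorem contMDiffOn_gluedJ (hf : f.IsSubordinate fun q => (chartAt (ProjModel E d) q).source)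
    {U : Set S.Proj} (hU : IsOpen U) {X : ∀ q : S.Proj, S.projHM q}
    (hX : ContMDiffOn 𝓘(ℝ, ProjModel E d) 𝓘(ℝ, ProjModel E d).tangent ∞
      (fun r => (⟨r, (X r : TangentSpace 𝓘(ℝ, ProjModel E d) r)⟩ :
        TangentBundle 𝓘(ℝ, ProjModel E d) S.Proj)) U) :
    ContMDiffOn 𝓘(ℝ, ProjModel E d) 𝓘(ℝ, ProjModel E d).tangent ∞
      (fun r => (⟨r, (gluedJ f r (X r) : TangentSpace 𝓘(ℝ, ProjModel E d) r)⟩ :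
        TangentBundle 𝓘(ℝ, ProjModel E d) S.Proj)) U := by
  simp only [gluedJ_eq_finsum]
  refine ContMDiffOn.finsum_section_of_locallyFinite (I := 𝓘(ℝ, ProjModel E d))
    (F := ProjModel E d) (V := (TangentSpace 𝓘(ℝ, ProjModel E d) : S.Proj → Type _))
    (t := fun i r => f i r • ((S.chartDataAt i).localJ r (X r) :
      TangentSpace 𝓘(ℝ, ProjModel E d) r)) ?_ fun i q hq => ?_
  · refine f.locallyFinite.subset fun i r hr => ?_
    exact left_ne_zero_of_smul hr
  · refine ContMDiffAt.contMDiffWithinAt ?_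
    -- `localJ` is the junk value zero outside its chart domain, so its smoothness is available only
    -- inside. Off the closed support of `f i`, which lies in that domain, the term vanishes on a
    -- neighbourhood.
    by_cases hi : q ∈ tsupport (f i)
    · exact ((f i).contMDiff q).smul_section
        ((S.chartDataAt i).contMDiffAt_localJ (chartAt_eq_chartDataAt i)
          (mem_affineSource_of_mem_tsupport hf hi) (hX.contMDiffAt (hU.mem_nhds hq)))
    · refine ((Bundle.contMDiff_zeroSection ℝ
        (TangentSpace 𝓘(ℝ, ProjModel E d) : S.Proj → Type _)) q).congr_of_eventuallyEq ?_
      filter_upwards [(isClosed_tsupport (f i)).isOpen_compl.mem_nhds hi] with r hr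
      simp [image_eq_zero_of_notMem_tsupport hr, Bundle.zeroSection]

/-- The almost CR structure on `ℙHM` determined by a partition of unity. -/
noncomputable def projStructure
    (hf : f.IsSubordinate fun q => (chartAt (ProjModel E d) q).source) :
    AlmostCRStructure 𝓘(ℝ, ProjModel E d) S.Proj d where
  HM := S.projHM
  J := gluedJ f
  J_J := gluedJ_gluedJ hf
  codim := finrank_projHM
  exists_frame := exists_frame_projHM
  smooth_J _ hU _ hX := contMDiffOn_gluedJ hf hU hX

theorem isAlmostCRMap_pr (hf : f.IsSubordinate fun q => (chartAt (ProjModel E d) q).source) :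
    IsAlmostCRMap (projStructure hf) S (Proj.pr S) where
  contMDiff := Proj.contMDiff_pr
  map_HM _ v := v.2
  map_J q v := congrArg Subtype.val (prHM_gluedJ hf q v)

end Gluing

end AlmostCRStructure

theorem corollary5p3 {m d : ℕ} {M : Type*} [TopologicalSpace M]
    [ChartedSpace (EuclideanSpace ℝ (Fin m)) M] [IsManifold (𝓡 m) ∞ M]
    [T2Space M] [SecondCountableTopology M] (S : AlmostCRStructure (𝓡 m) M d) :
    ∃ S' : AlmostCRStructure
        𝓘(ℝ, AlmostCRStructure.ProjModel (EuclideanSpace ℝ (Fin m)) d) S.Proj d,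
      IsAlmostCRMap S' S (AlmostCRStructure.Proj.pr S) := by
  -- Existence of the partition of unity uses that `ℙHM` is Hausdorff and σ-compact.
  obtain ⟨f, hf⟩ := SmoothPartitionOfUnity.exists_isSubordinate_chartAt_source
    𝓘(ℝ, AlmostCRStructure.ProjModel (EuclideanSpace ℝ (Fin m)) d) S.Proj
  exact ⟨AlmostCRStructure.projStructure hf, AlmostCRStructure.isAlmostCRMap_pr hf⟩
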